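/- Let $K$ be a field of characteristic zero, $L=\bigoplus_{i\in\mathbb Z} L_i$ a graded $K$-vector space and $\alpha:L\to L$ a linear map of degree $0$. For homogeneous $a_1,\dots,a_n$ and $\sigma\in S_n$ let $\epsilon(\sigma)$ be the Koszul sign, defined by $a_1\wedge\cdots\wedge a_n=\epsilon(\sigma)\,a_{\sigma(1)}\wedge\cdots\wedge a_{\sigma(n)}$ in the free graded commutative algebra, and let $\chi(\sigma)=\operatorname{sgn}(\sigma)\,\epsilon(\sigma)$. An $HL_\infty$-algebra structure on $L$ with respect to $\alpha$ is a family of multilinear maps $l_k:L^{\otimes k}\to L$, $k\ge 1$, of degree $k-2$, that are skew-symmetric ($l_k(a_{\sigma(1)},\dots,a_{\sigma(k)})=\chi(\sigma)\,l_k(a_1,\dots,a_k)$), satisfy $\alpha(l_k(a_1,\dots,a_k))=l_k(\alpha a_1,\dots,\alpha a_k)$, and such that for all $n\ge1$ and homogeneous $a_1,\dots,a_n\in L$ $$\sum_{\substack{i+j=n+1\\ i,j\ge 1}}\ \sum_{\sigma\in Sh(i,n-i)}\chi(\sigma)(-1)^{i(j-1)}\,l_j\big(l_i(a_{\sigma(1)},\dots,a_{\sigma(i)}),\alpha^{i-1}a_{\sigma(i+1)},\dots,\alpha^{i-1}a_{\sigma(n)}\big)=0,$$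 where $Sh(i,n-i)$ is the set of $(i,n-i)$-unshuffles. Let $V=sL$ be the suspension, $V_i=L_{i-1}$, with the map of degree $0$ induced by $\alpha$, also denoted $\alpha$. Let $SV=\bigoplus_{k\ge0}S^kV$ be the free graded commutative algebra on $V$, with the unshuffle coproduct $\triangle$, the projection $\pi:SV\to S^1V=V$ and the induced map $\alpha(v_1\wedge\cdots\wedge v_n)=\alpha v_1\wedge\cdots\wedge\alpha v_n$. For $n\ge1$ and a linear map $\varrho:S^nV\to V$ of degree $p$ with $\alpha\circ\varrho=\varrho\circ\alpha^{\wedge n}$, extended by zero to $SV$, let $\widetilde\varrho:SV\to SV$ be its unique lift ($\pi\circ\widetilde\varrho=\varrho$) of degree $p$ with $\alpha\circ\widetilde\varrho=\widetilde\varrho\circ\alpha$ and $\triangle\circ\widetilde\varrho=(\widetilde\varrho\otimes\alpha^{n-1}+\alpha^{n-1}\otimes\widetilde\varrho)\circ\triangle$ (with the Koszul sign rule). Let $\mathrm{Coder}^p_\alpha(SV)$ be the set of all maps $D=\sum_{n\ge1}\widetilde{\varrho_n}:SV\to SV$, where $\varrho_n:S^nV\to V$ is of degree $p$ with $\alpha\circ\varrho_n=\varrho_n\circ\alpha^{\wedge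 n}$. Theorem. $HL_\infty$-algebra structures on $L$ with respect to $\alpha$ are equivalent to elements $D\in\mathrm{Coder}^{-1}_\alpha(SV)$ with $D\circ D=0$: the assignment $$(l_k)_{k\ge1}\ \longmapsto\ D=\sum_{k\ge1}\widetilde{\varrho_k},\qquad \varrho_k=(-1)^{\frac{k(k-1)}2}\,s\circ l_k\circ(s^{-1})^{\otimes k},$$ is a bijection from the set of $HL_\infty$-algebra structures on $L$ with respect to $\alpha$ onto $\{D\in\mathrm{Coder}^{-1}_\alpha(SV) : D\circ D=0\}$. -/

import Mathlib

open scoped TensorProduct DirectSum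

noncomputable section

namespace HomLie

/-! ### Graded vector spaces, Koszul signs, suspension -/

section Basic

variable {K V : Type*} [Field K] [AddCommGroup V] [Module K V]

/-- `f` is a linear map of degree `r`. -/
def HasDegree {W : Type*} [AddCommGroup W] [Module K W] (𝓥 : ℤ → Submodule K V)
    (𝓦 : ℤ → Submodule K W) (r : ℤ) (f : V →ₗ[K] W) : Prop :=
  ∀ i, ∀ x ∈ 𝓥 i, f x ∈ 𝓦 (i + r)

/-- The suspension `sV`: the same vector space with the grading `(sV)_i = V_{i-1}`. The degree
`+1` map `s : V → sV` is the identity of the underlying vector space. -/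
def susp (𝓥 : ℤ → Submodule K V) : ℤ → Submodule K V := fun i => 𝓥 (i - 1)

lemma HasDegree.susp {𝓥 : ℤ → Submodule K V} {f : V →ₗ[K] V} (hf : HasDegree 𝓥 𝓥 0 f) :
    HasDegree (susp 𝓥) (susp 𝓥) 0 f := fun i x hx => by
  have := hf (i - 1) x hx
  rw [add_zero] at this ⊢
  exact this

lemma isInternal_susp (𝓥 : ℤ → Submodule K V) (h : DirectSum.IsInternal 𝓥) :
    DirectSum.IsInternal (susp 𝓥) := by
  rw [DirectSum.isInternal_submodule_iff_iSupIndep_and_iSup_eq_top] at h ⊢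
  refine ⟨h.1.comp (f := fun i : ℤ => i - 1) (fun a b hab => by simpa using hab), ?_⟩
  rw [← h.2]
  exact (Equiv.subRight (1 : ℤ)).iSup_comp (g := 𝓥)

instance instDecompositionSusp (𝓥 : ℤ → Submodule K V) [DirectSum.Decomposition 𝓥] :
    DirectSum.Decomposition (susp 𝓥) :=
  (isInternal_susp 𝓥 (DirectSum.Decomposition.isInternal 𝓥)).chooseDecomposition

/-- The linear map `x ↦ (-1)^{p|x|} x` of a graded vector space. -/
def koszulTwist (𝓥 : ℤ → Submodule K V) [DirectSum.Decomposition 𝓥] (p : ℤ) : V →ₗ[K] V :=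
  DirectSum.coeLinearMap 𝓥 ∘ₗ
    DirectSum.lmap (fun i => (((Int.negOnePow (p * i) : ℤˣ) : ℤ) : K) • LinearMap.id) ∘ₗ
      (DirectSum.decomposeLinearEquiv 𝓥).toLinearMap

/-- The Koszul sign `ε(σ; a₁, …, aₙ)` for homogeneous elements of degrees `d₁, …, dₙ`,
characterised by `a₁ ∧ ⋯ ∧ aₙ = ε(σ) a_{σ(1)} ∧ ⋯ ∧ a_{σ(n)}`: each pair of elements whose order
is reversed contributes `(-1)^{|a||b|}`. -/
def koszulSign {n : ℕ} (σ : Equiv.Perm (Fin n)) (d : Fin n → ℤ) : ℤˣ :=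
  ∏ p : Fin n, ∏ q : Fin n,
    if p < q ∧ σ q < σ p then Int.negOnePow (d (σ p) * d (σ q)) else 1

/-- The sign `χ(σ) = (-1)^σ ε(σ)`. -/
def skewSign {n : ℕ} (σ : Equiv.Perm (Fin n)) (d : Fin n → ℤ) : ℤˣ :=
  Equiv.Perm.sign σ * koszulSign σ d

/-- The `(i, n-i)`-unshuffles: permutations with `σ(1) < ⋯ < σ(i)` and `σ(i+1) < ⋯ < σ(n)`. -/
def unshuffles (n i : ℕ) : Finset (Equiv.Perm (Fin n)) :=
  {σ | ∀ p q : Fin n, p < q → ((q : ℕ) < i ∨ i ≤ (p : ℕ)) → σ p < σ q}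

end Basic

/-! ### Strongly homotopy hom-Lie algebras -/

section HLInfinity

variable {K L : Type*} [Field K] [AddCommGroup L] [Module K L]

/-- For `i, j ≥ 1` with `i + j = n + 1`, the element
`l_j (l_i (a_{σ(1)}, …, a_{σ(i)}), α^{i-1} a_{σ(i+1)}, …, α^{i-1} a_{σ(n)})`. -/
def nested (α : L →ₗ[K] L) (l : ∀ k : ℕ, MultilinearMap K (fun _ : Fin k => L) L) {n : ℕ}
    (a : Fin n → L) (σ : Equiv.Perm (Fin n)) (i j : ℕ) (hi : 1 ≤ i) (hj : 1 ≤ j)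
    (h : i + j = n + 1) : L :=
  l j fun t : Fin j =>
    if (t : ℕ) = 0 then l i fun u : Fin i => a (σ ⟨u, by omega⟩)
    else (α ^ (i - 1)) (a (σ ⟨i + t - 1, by omega⟩))

/-- An `HL_∞`-algebra structure on the graded vector space `L = ⨁ L_i` with respect to `α`.
The operations are the `l k` with `k ≥ 1`; the unused `l 0` is normalised to `0`. -/
@[ext]
structure HLInfinity (𝓛 : ℤ → Submodule K L) (α : L →ₗ[K] L) where
  l : ∀ k : ℕ, MultilinearMap K (fun _ : Fin k => L) L
  l_zero : l 0 = 0
  degree : ∀ k, 1 ≤ k → ∀ (d : Fin k → ℤ) (a : Fin k → L), (∀ t, a t ∈ 𝓛 (d t)) →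
    l k a ∈ 𝓛 (∑ t, d t + ((k : ℤ) - 2))
  skew : ∀ k, 1 ≤ k → ∀ (d : Fin k → ℤ) (a : Fin k → L), (∀ t, a t ∈ 𝓛 (d t)) →
    ∀ σ : Equiv.Perm (Fin k), l k (fun t => a (σ t)) = skewSign σ d • l k a
  comm : ∀ k, 1 ≤ k → ∀ a : Fin k → L, α (l k a) = l k (fun t => α (a t))
  /-- The sum over `i + j = n + 1`; the summation index is `i - 1`, and `j = n - (i - 1)`. -/
  jacobi : ∀ n, 1 ≤ n → ∀ (d : Fin n → ℤ) (a : Fin n → L), (∀ t, a t ∈ 𝓛 (d t)) →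
    ∑ r : Fin n, ∑ σ ∈ unshuffles n ((r : ℕ) + 1),
      (skewSign σ d * (-1) ^ (((r : ℕ) + 1) * (n - (r : ℕ) - 1))) •
        nested α l a σ ((r : ℕ) + 1) (n - (r : ℕ)) (by omega) (by omega) (by omega) = 0

end HLInfinity

/-! ### The graded symmetric coalgebra -/

section GSym

variable {K V : Type*} [Field K] [AddCommGroup V] [Module K V] (𝓥 : ℤ → Submodule K V)

/-- The two-sided ideal of the tensor algebra generated by `x ⊗ y - (-1)^{|x||y|} y ⊗ x`. -/
def symIdeal : TwoSidedIdeal (TensorAlgebra K V) :=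
  TwoSidedIdeal.span {z | ∃ (i j : ℤ) (x y : V), x ∈ 𝓥 i ∧ y ∈ 𝓥 j ∧
    z = TensorAlgebra.ι K x * TensorAlgebra.ι K y -
      Int.negOnePow (i * j) • (TensorAlgebra.ι K y * TensorAlgebra.ι K x)}

/-- The free graded commutative algebra `SV`; its product is the product `∧`. -/
def GSym : Type _ := TensorAlgebra K V ⧸ (symIdeal 𝓥).asIdeal

instance instRingGSym : Ring (GSym 𝓥) :=
  inferInstanceAs (Ring (TensorAlgebra K V ⧸ (symIdeal 𝓥).asIdeal))

instance instAlgebraGSym : Algebra K (GSym 𝓥) :=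
  inferInstanceAs (Algebra K (TensorAlgebra K V ⧸ (symIdeal 𝓥).asIdeal))

namespace GSym

/-- The quotient map `TV → SV`. -/
def mk : TensorAlgebra K V →ₐ[K] GSym 𝓥 := Ideal.Quotient.mkₐ K (symIdeal 𝓥).asIdeal

/-- The inclusion `V → SV`. -/
def ι : V →ₗ[K] GSym 𝓥 := (mk 𝓥).toLinearMap ∘ₗ TensorAlgebra.ι K

/-- `v₁ ∧ ⋯ ∧ vₙ`. -/
def wedge {n : ℕ} (v : Fin n → V) : GSym 𝓥 := (List.ofFn fun t => ι 𝓥 (v t)).prod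

lemma mk_surjective : Function.Surjective (mk 𝓥) := Ideal.Quotient.mkₐ_surjective _ _

lemma mk_eq_zero {x : TensorAlgebra K V} (h : x ∈ symIdeal 𝓥) : mk 𝓥 x = 0 :=
  Ideal.Quotient.eq_zero_iff_mem.2 (TwoSidedIdeal.mem_asIdeal.2 h)

lemma ι_mul_ι {i j : ℤ} {x y : V} (hx : x ∈ 𝓥 i) (hy : y ∈ 𝓥 j) :
    ι 𝓥 x * ι 𝓥 y = Int.negOnePow (i * j) • (ι 𝓥 y * ι 𝓥 x) := by
  have h := mk_eq_zero 𝓥 (TwoSidedIdeal.subset_span ⟨i, j, x, y, hx, hy, rfl⟩)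
  rw [map_sub, sub_eq_zero] at h
  rcases Int.units_eq_one_or (Int.negOnePow (i * j)) with h' | h' <;> rw [h'] at h ⊢ <;> simpa [ι] using h

lemma wedge_zero (v : Fin 0 → V) : wedge 𝓥 v = 1 := by simp [wedge]

lemma wedge_succ {n : ℕ} (v : Fin (n + 1) → V) :
    wedge 𝓥 v = ι 𝓥 (v 0) * wedge 𝓥 (fun t => v t.succ) := by
  simp [wedge, List.ofFn_succ]

variable {A : Type*} [Ring A] [Algebra K A]

/-- The universal property of `SV`. -/
def lift (f : V →ₗ[K] A)
    (hf : ∀ i j, ∀ x ∈ 𝓥 i, ∀ y ∈ 𝓥 j, f x * f y = Int.negOnePow (i * j) • (f y * f x)) :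
    GSym 𝓥 →ₐ[K] A :=
  Ideal.Quotient.liftₐ (symIdeal 𝓥).asIdeal (TensorAlgebra.lift K f) (by
    intro z hz
    have hle : symIdeal 𝓥 ≤ TwoSidedIdeal.ker (TensorAlgebra.lift K f) := by
      rw [symIdeal, TwoSidedIdeal.span_le]
      rintro _ ⟨i, j, x, y, hx, hy, rfl⟩
      have := hf i j x hx y hy
      rw [SetLike.mem_coe, TwoSidedIdeal.mem_ker, map_sub, sub_eq_zero]
      rcases Int.units_eq_one_or (Int.negOnePow (i * j)) with h' | h' <;> rw [h'] at this ⊢ <;> simpa using this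
    exact (TwoSidedIdeal.mem_ker _).1 (hle (TwoSidedIdeal.mem_asIdeal.1 hz)))

@[simp] lemma lift_ι (f : V →ₗ[K] A) (hf) (v : V) : lift 𝓥 f hf (ι 𝓥 v) = f v := by
  change TensorAlgebra.lift K f (TensorAlgebra.ι K v) = f v
  simp

variable {𝓥} in
lemma algHom_ext {f g : GSym 𝓥 →ₐ[K] A} (h : ∀ v, f (ι 𝓥 v) = g (ι 𝓥 v)) : f = g := by
  have : f.comp (mk 𝓥) = g.comp (mk 𝓥) := by
    ext v
    exact h v
  ext x
  obtain ⟨x, rfl⟩ := mk_surjective 𝓥 x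
  exact DFunLike.congr_fun this x

/-- The linear projection `π : SV → V`, the inverse of `ι` on `S¹V` and zero on `SᵏV`, `k ≠ 1`. -/
def proj : GSym 𝓥 →ₗ[K] V :=
  Submodule.liftQ ((symIdeal 𝓥).asIdeal.restrictScalars K) TensorAlgebra.ιInv (by
    let _ : Module Kᵐᵒᵖ V := Module.compHom _ ((RingHom.id K).fromOpposite mul_comm)
    have _ : IsCentralScalar K V := ⟨fun r m => rfl⟩
    intro z hz
    have hle : symIdeal 𝓥 ≤
        TwoSidedIdeal.ker (TensorAlgebra.toTrivSqZeroExt (R := K) (M := V)) := by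
      rw [symIdeal, TwoSidedIdeal.span_le]
      rintro _ ⟨i, j, x, y, hx, hy, rfl⟩
      rw [SetLike.mem_coe, TwoSidedIdeal.mem_ker, map_sub, sub_eq_zero]
      rcases Int.units_eq_one_or (Int.negOnePow (i * j)) with h' | h' <;> rw [h'] <;> simp
    have h0 := (TwoSidedIdeal.mem_ker _).1 (hle (TwoSidedIdeal.mem_asIdeal.1 hz))
    change TrivSqZeroExt.snd (TensorAlgebra.toTrivSqZeroExt z) = 0
    rw [h0, TrivSqZeroExt.snd_zero])

/-- The subspace `SⁿV` of `SV`, spanned by the `v₁ ∧ ⋯ ∧ vₙ`. -/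
def symPow (n : ℕ) : Submodule K (GSym 𝓥) := Submodule.span K (Set.range (wedge 𝓥 (n := n)))

/-- The degree `i` part of `SV`, spanned by the `v₁ ∧ ⋯ ∧ vₙ`, for any `n`, with `vₜ` homogeneous
and `|v₁| + ⋯ + |vₙ| = i`. -/
def deg (i : ℤ) : Submodule K (GSym 𝓥) :=
  Submodule.span K {z | ∃ (n : ℕ) (d : Fin n → ℤ) (v : Fin n → V),
    (∀ t, v t ∈ 𝓥 (d t)) ∧ ∑ t, d t = i ∧ z = wedge 𝓥 v}

lemma wedge_mem_deg {n : ℕ} {d : Fin n → ℤ} {v : Fin n → V} (h : ∀ t, v t ∈ 𝓥 (d t)) :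
    wedge 𝓥 v ∈ deg 𝓥 (∑ t, d t) :=
  Submodule.subset_span ⟨n, d, v, h, rfl, rfl⟩

lemma ι_mem_deg {i : ℤ} {x : V} (hx : x ∈ 𝓥 i) : ι 𝓥 x ∈ deg 𝓥 i := by
  refine Submodule.subset_span ⟨1, fun _ => i, fun _ => x, fun _ => hx, by simp, by simp [wedge]⟩

instance instGradedMonoidDeg : SetLike.GradedMonoid (deg 𝓥) where
  one_mem := Submodule.subset_span ⟨0, Fin.elim0, Fin.elim0, fun t => t.elim0, by simp,
    by simp [wedge]⟩
  mul_mem := by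
    intro i j a b ha hb
    refine Submodule.span_induction₂ (p := fun a b _ _ => a * b ∈ deg 𝓥 (i + j))
      ?_ ?_ ?_ ?_ ?_ ?_ ?_ ha hb
    · rintro _ _ ⟨n, d, v, hv, rfl, rfl⟩ ⟨m, e, w, hw, rfl, rfl⟩
      refine Submodule.subset_span ⟨n + m, Fin.append d e, Fin.append v w, ?_, ?_, ?_⟩
      · intro t
        induction t using Fin.addCases <;> simp [hv, hw]
      · simp [Fin.sum_univ_add]
      · simp [wedge, List.ofFn_add]
    · intro y _; simp
    · intro x _; simp
    · intro x y z _ _ _ hx hy; rw [add_mul]; exact add_mem hx hy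
    · intro x y z _ _ _ hx hy; rw [mul_add]; exact add_mem hx hy
    · intro r x y _ _ h; rw [smul_mul_assoc]; exact Submodule.smul_mem _ _ h
    · intro r x y _ _ h; rw [mul_smul_comm]; exact Submodule.smul_mem _ _ h

lemma of_congr {i j : ℤ} (h : i = j) (x : deg 𝓥 i) (y : deg 𝓥 j) (hxy : (x : GSym 𝓥) = y) :
    DirectSum.of (fun i => deg 𝓥 i) i x = DirectSum.of (fun i => deg 𝓥 i) j y := by
  subst h
  rw [Subtype.ext hxy]

section Decomposition

variable [DirectSum.Decomposition 𝓥]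

/-- Auxiliary map for the decomposition of `SV` into its homogeneous parts. -/
def decomposeι : V →ₗ[K] ⨁ i, deg 𝓥 i :=
  DirectSum.lmap (fun i => ((ι 𝓥).restrict (fun _ hx => ι_mem_deg 𝓥 hx) : 𝓥 i →ₗ[K] deg 𝓥 i)) ∘ₗ
    (DirectSum.decomposeLinearEquiv 𝓥).toLinearMap

lemma decomposeι_of_mem {i : ℤ} {x : V} (hx : x ∈ 𝓥 i) :
    decomposeι 𝓥 x = DirectSum.of (fun i => deg 𝓥 i) i ⟨ι 𝓥 x, ι_mem_deg 𝓥 hx⟩ := by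
  simp only [decomposeι, LinearMap.comp_apply, LinearEquiv.coe_coe,
    DirectSum.decomposeLinearEquiv_apply, DirectSum.decompose_of_mem 𝓥 hx]
  rw [DirectSum.lmap_of]
  rfl

lemma decomposeι_mul (i j : ℤ) (x : V) (hx : x ∈ 𝓥 i) (y : V) (hy : y ∈ 𝓥 j) :
    decomposeι 𝓥 x * decomposeι 𝓥 y =
      Int.negOnePow (i * j) • (decomposeι 𝓥 y * decomposeι 𝓥 x) := by
  rw [decomposeι_of_mem 𝓥 hx, decomposeι_of_mem 𝓥 hy, DirectSum.of_mul_of, DirectSum.of_mul_of]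
  have h := ι_mul_ι 𝓥 hx hy
  rcases Int.units_eq_one_or (Int.negOnePow (i * j)) with h' | h' <;> rw [h'] at h ⊢
  · rw [one_smul] at h ⊢
    exact of_congr 𝓥 (add_comm _ _) _ _ h
  · rw [Units.neg_smul, one_smul] at h
    have e : ∀ z : ⨁ i, deg 𝓥 i, (-1 : ℤˣ) • z = -z := fun z => by
      rw [Units.smul_def, Units.val_neg, Units.val_one, neg_one_zsmul]
    rw [e, ← map_neg]
    exact of_congr 𝓥 (add_comm _ _) _ _ h

/-- Auxiliary map for the decomposition of `SV` into its homogeneous parts. -/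
def decomposeAlgHom : GSym 𝓥 →ₐ[K] ⨁ i, deg 𝓥 i :=
  lift 𝓥 (A := ⨁ i, deg 𝓥 i) (decomposeι 𝓥) (decomposeι_mul 𝓥)

lemma decomposeAlgHom_wedge {n : ℕ} {d : Fin n → ℤ} {v : Fin n → V} (h : ∀ t, v t ∈ 𝓥 (d t)) :
    decomposeAlgHom 𝓥 (wedge 𝓥 v) =
      DirectSum.of (fun i => deg 𝓥 i) (∑ t, d t) ⟨wedge 𝓥 v, wedge_mem_deg 𝓥 h⟩ := by
  induction n with
  | zero =>
    have : decomposeAlgHom 𝓥 (wedge 𝓥 v) = 1 := by rw [wedge_zero, map_one]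
    rw [this, DirectSum.one_def]
    exact of_congr 𝓥 (by simp) _ _ (by simp [wedge_zero])
  | succ n ih =>
    have h1 : decomposeAlgHom 𝓥 (wedge 𝓥 v) = decomposeι 𝓥 (v 0) *
        decomposeAlgHom 𝓥 (wedge 𝓥 (fun t => v t.succ)) := by
      rw [wedge_succ, map_mul, decomposeAlgHom, lift_ι]
    rw [h1, ih (fun t => h t.succ), decomposeι_of_mem 𝓥 (h 0), DirectSum.of_mul_of]
    exact of_congr 𝓥 (by rw [Fin.sum_univ_succ]) _ _ (wedge_succ 𝓥 v).symm

lemma coe_decomposeι (v : V) : DirectSum.coeLinearMap (deg 𝓥) (decomposeι 𝓥 v) = ι 𝓥 v := by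
  induction v using DirectSum.Decomposition.inductionOn 𝓥 with
  | zero => simp
  | homogeneous x =>
    rw [decomposeι_of_mem 𝓥 x.2]
    exact DirectSum.coeLinearMap_of _ _ _
  | add x y hx hy => rw [map_add, map_add, map_add, hx, hy]

/-- `SV` is a graded algebra. -/
instance instGradedAlgebraDeg : GradedAlgebra (deg 𝓥) :=
  GradedAlgebra.ofAlgHom (deg 𝓥) (decomposeAlgHom 𝓥)
    (by
      refine algHom_ext fun v => ?_
      rw [AlgHom.comp_apply, decomposeAlgHom, lift_ι]
      exact coe_decomposeι 𝓥 v)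
    (by
      rintro i ⟨x, hx⟩
      induction hx using Submodule.span_induction with
      | mem x h =>
        obtain ⟨n, d, v, hv, rfl, rfl⟩ := h
        exact decomposeAlgHom_wedge 𝓥 hv
      | zero =>
        rw [map_zero]
        exact (map_zero (DirectSum.of (fun i => deg 𝓥 i) i)).symm
      | add x y hx hy ihx ihy =>
        have : (⟨x + y, add_mem hx hy⟩ : deg 𝓥 i) = ⟨x, hx⟩ + ⟨y, hy⟩ := rfl
        change decomposeAlgHom 𝓥 (x + y) = DirectSum.of (fun i => deg 𝓥 i) i ⟨x + y, add_mem hx hy⟩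
        rw [this, map_add, map_add]
        exact congrArg₂ _ ihx ihy
      | smul r x hx ih =>
        have : (⟨r • x, Submodule.smul_mem _ r hx⟩ : deg 𝓥 i) = r • ⟨x, hx⟩ := rfl
        change decomposeAlgHom 𝓥 (r • x) =
          DirectSum.lof K ℤ (fun i => deg 𝓥 i) i ⟨r • x, Submodule.smul_mem _ r hx⟩
        rw [this, map_smul, map_smul]
        exact congrArg _ ih)

open GradedTensorProduct in
/-- The map `v ↦ v ⊗ 1 + 1 ⊗ v`. -/
def primitive : V →ₗ[K] (deg 𝓥 ᵍ⊗[K] deg 𝓥) :=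
  (includeLeft (deg 𝓥) (deg 𝓥)).toLinearMap ∘ₗ ι 𝓥 +
    (includeRight (deg 𝓥) (deg 𝓥)).toLinearMap ∘ₗ ι 𝓥

open GradedTensorProduct in
lemma primitive_mul (i j : ℤ) (x : V) (hx : x ∈ 𝓥 i) (y : V) (hy : y ∈ 𝓥 j) :
    primitive 𝓥 x * primitive 𝓥 y = Int.negOnePow (i * j) • (primitive 𝓥 y * primitive 𝓥 x) := by
  have key : ∀ (i j : ℤ) (x y : V), x ∈ 𝓥 i → y ∈ 𝓥 j → primitive 𝓥 x * primitive 𝓥 y =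
      tmul K (ι 𝓥 x * ι 𝓥 y) 1 + tmul K (ι 𝓥 x) (ι 𝓥 y) +
        Int.negOnePow (i * j) • tmul K (ι 𝓥 y) (ι 𝓥 x) + tmul K 1 (ι 𝓥 x * ι 𝓥 y) := by
    intro i j x y hx hy
    have e : ∀ v, primitive 𝓥 v = tmul K (ι 𝓥 v) 1 + tmul K 1 (ι 𝓥 v) := fun v => rfl
    have hx1 := ι_mem_deg 𝓥 hx
    have hy1 := ι_mem_deg 𝓥 hy
    have h1 := tmul_one_mul_coe_tmul (deg 𝓥) (deg 𝓥) (R := K) (ι 𝓥 x) ⟨_, hy1⟩ 1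
    have h2 := tmul_one_mul_one_tmul (deg 𝓥) (deg 𝓥) (R := K) (ι 𝓥 x) (ι 𝓥 y)
    have h3 := tmul_coe_mul_coe_tmul (deg 𝓥) (deg 𝓥) (R := K) 1 ⟨_, hx1⟩ ⟨_, hy1⟩ 1
    have h4 := tmul_coe_mul_one_tmul (deg 𝓥) (deg 𝓥) (R := K) 1 ⟨_, hx1⟩ (ι 𝓥 y)
    simp only [one_mul, mul_one] at h1 h2 h3 h4
    rw [e, e, mul_add, add_mul, add_mul, h1, h2, h3, h4]
    have h5 : ((-1 : ℤˣ) ^ (i * j)) = Int.negOnePow (i * j) := rfl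
    rw [h5]
    abel
  rw [key i j x y hx hy, key j i y x hy hx, mul_comm j i]
  have h := ι_mul_ι 𝓥 hx hy
  rcases Int.units_eq_one_or (Int.negOnePow (i * j)) with h' | h' <;> rw [h'] at h ⊢
  · simp only [one_smul] at h ⊢
    rw [h]
    abel
  · simp only [Units.neg_smul, one_smul] at h ⊢
    rw [h]
    have e1 : tmul (𝒜 := deg 𝓥) (ℬ := deg 𝓥) K (-(ι 𝓥 y * ι 𝓥 x)) 1 =
        -tmul K (ι 𝓥 y * ι 𝓥 x) 1 :=
      (congrArg _ (TensorProduct.neg_tmul _ _)).trans (map_neg _ _)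
    have e2 : tmul (𝒜 := deg 𝓥) (ℬ := deg 𝓥) K 1 (-(ι 𝓥 y * ι 𝓥 x)) =
        -tmul K 1 (ι 𝓥 y * ι 𝓥 x) := (congrArg _ (TensorProduct.tmul_neg _ _)).trans (map_neg _ _)
    rw [e1, e2]
    abel

open GradedTensorProduct in
/-- The coproduct as a map of algebras to the graded tensor product `SV ⊗ SV`, whose product is
`(x ⊗ y)(x' ⊗ y') = (-1)^{|y||x'|} xx' ⊗ yy'`. It is determined by `v ↦ v ⊗ 1 + 1 ⊗ v` for
`v ∈ V`. -/
def comulAlgHom : GSym 𝓥 →ₐ[K] (deg 𝓥 ᵍ⊗[K] deg 𝓥) :=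
  lift 𝓥 (primitive 𝓥) (primitive_mul 𝓥)

/-- The coproduct `△ : SV → SV ⊗ SV`. Expanding the product of the `vₜ ⊗ 1 + 1 ⊗ vₜ`,
`△(v₁ ∧ ⋯ ∧ vₙ) = ∑_{i=0}^{n} ∑_{σ ∈ Sh(i,n-i)}
  ε(σ) (v_{σ(1)} ∧ ⋯ ∧ v_{σ(i)}) ⊗ (v_{σ(i+1)} ∧ ⋯ ∧ v_{σ(n)})`. -/
def comul : GSym 𝓥 →ₗ[K] GSym 𝓥 ⊗[K] GSym 𝓥 :=
  (GradedTensorProduct.of K (deg 𝓥) (deg 𝓥)).symm.toLinearMap ∘ₗ (comulAlgHom 𝓥).toLinearMap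

end Decomposition

/-- The map `α : SV → SV`, `v₁ ∧ ⋯ ∧ vₙ ↦ α(v₁) ∧ ⋯ ∧ α(vₙ)`, induced by a linear map
`α : V → V` of degree `0`. -/
def map (α : V →ₗ[K] V) (hα : HasDegree 𝓥 𝓥 0 α) : GSym 𝓥 →ₐ[K] GSym 𝓥 :=
  lift 𝓥 (ι 𝓥 ∘ₗ α) (fun i j x hx y hy => by
    have hx' := hα i x hx
    have hy' := hα j y hy
    rw [add_zero] at hx' hy'
    exact ι_mul_ι 𝓥 hx' hy')

end GSym

/-! ### Twisted coderivations -/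

open GSym

variable [DirectSum.Decomposition 𝓥] (α : V →ₗ[K] V) (hα : HasDegree 𝓥 𝓥 0 α)

/-- `ρ : SⁿV → V` is a linear map of degree `p` with `α ∘ ρ = ρ ∘ α^{∧n}`. Such a map is viewed
as a linear map `SV → V` that vanishes on `SᵏV` for `k ≠ n`. -/
structure IsComponent (p : ℤ) (n : ℕ) (ρ : GSym 𝓥 →ₗ[K] V) : Prop where
  supported : ∀ k, k ≠ n → ∀ x ∈ symPow 𝓥 k, ρ x = 0
  degree : HasDegree (deg 𝓥) 𝓥 p ρ
  comm : ∀ v : Fin n → V, α (ρ (wedge 𝓥 v)) = ρ (wedge 𝓥 fun t => α (v t))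

/-- `R = ρ̃`: the map `R : SV → SV` of degree `p` lifts `ρ : SⁿV → V`, commutes with `α`, and is an
`α^{n-1}`-twisted coderivation: `△ ∘ R = (R ⊗ α^{n-1} + α^{n-1} ⊗ R) ∘ △`, where, by the Koszul
sign rule, `(α^{n-1} ⊗ R)(x ⊗ y) = (-1)^{p|x|} α^{n-1} x ⊗ R y`. -/
structure IsTwistedLift (p : ℤ) (n : ℕ) (ρ : GSym 𝓥 →ₗ[K] V) (R : GSym 𝓥 →ₗ[K] GSym 𝓥) :
    Prop where
  degree : HasDegree (deg 𝓥) (deg 𝓥) p R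
  lifts : proj 𝓥 ∘ₗ R = ρ
  comm : (map 𝓥 α hα).toLinearMap ∘ₗ R = R ∘ₗ (map 𝓥 α hα).toLinearMap
  coder : comul 𝓥 ∘ₗ R =
    (TensorProduct.map R (map 𝓥 α hα ^ (n - 1)).toLinearMap +
      TensorProduct.map ((map 𝓥 α hα ^ (n - 1)).toLinearMap ∘ₗ koszulTwist (deg 𝓥) p) R) ∘ₗ
        comul 𝓥

/-- `D = ∑_{n ≥ 1} ρ̃ₙ` for maps `ρₙ : SⁿV → V`, `n ≥ 1`, of degree `p` compatible with `α`. The sum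
is pointwise finite. -/
def IsSumOfLifts (p : ℤ) (ρ : ℕ → GSym 𝓥 →ₗ[K] V) (D : GSym 𝓥 →ₗ[K] GSym 𝓥) : Prop :=
  (∀ n, 1 ≤ n → IsComponent 𝓥 α p n (ρ n)) ∧
  ∃ R : ℕ → GSym 𝓥 →ₗ[K] GSym 𝓥, (∀ n, 1 ≤ n → IsTwistedLift 𝓥 α hα p n (ρ n) (R n)) ∧
    ∀ x, {n | 1 ≤ n ∧ R n x ≠ 0}.Finite ∧ D x = ∑ᶠ (n : ℕ) (_ : 1 ≤ n), R n x

/-- `Coder^p_α(SV)`. -/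
def Coder (p : ℤ) : Set (GSym 𝓥 →ₗ[K] GSym 𝓥) :=
  {D | ∃ ρ : ℕ → GSym 𝓥 →ₗ[K] V, IsSumOfLifts 𝓥 α hα p ρ D}

end GSym

end HomLie

end

open scoped TensorProduct DirectSum

noncomputable section

/-! Suspension turns skew-symmetric operations of degree `k - 2` on `L` into graded symmetric maps
`S^k(sL) → sL` of degree `-1`. The theorem says that under this translation the Jacobi identities
become `D ∘ D = 0`.

A component `ρ` has an explicit lift: split off a factor with the coproduct, apply `ρ` to it, apply
`α^{n-1}` to the rest and multiply back (`twistedLift`). That it satisfies the coderivation identity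
follows by induction on word length, from the recursion `△(v ∧ x) = (v ⊗ 1 + 1 ⊗ v) △x`. The lift is
unique by a rigidity statement, `eq_zero_of_coderivation`: if a twisted coderivation projects to
zero and kills all shorter words, its value on a word is primitive. In characteristic zero primitive
elements lie in `V` (`eq_ι_of_primitive`), so that value equals its own projection, which is zero.
Hence `D` and its components `ρ_k` determine each other.

For the square, the summands `ρ̃_j ∘ ρ̃_i` with `i + j = n + 1` are collected in `squarePart n`.
Since the degree is odd, the mixed terms cancel in pairs and `squarePart n` is again an
`α^{n-1}`-twisted coderivation (`squarePart_coder`). The twist depends on `n`, so rigidity is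
applied to each `n` separately: `D ∘ D = 0` exactly when every projection `∑ ρ_j ∘ ρ̃_i` vanishes on
`SⁿV`.

The unshuffle formula `comul_wedge` makes these projections explicit. The sign identities
`koszulSign_add_one` and `decalageSign_nested` identify them with the Jacobi sums, up to one global
sign. -/

namespace HomLie

/-! ### Signs in `K`, the Koszul twist, and maps of given degree. -/

section Twist

variable {K V W : Type*} [Field K] [AddCommGroup V] [Module K V] [AddCommGroup W] [Module K W]

variable (K) in
/-- The image of a sign in the field `K`. -/
def signHom : ℤˣ →* K := (Int.castRingHom K : ℤ →* K).comp (Units.coeHom ℤ)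

lemma signHom_apply (u : ℤˣ) : signHom K u = ((u : ℤ) : K) := rfl

lemma signHom_neg_one : signHom K (-1) = -1 := by simp [signHom_apply]

lemma units_smul_eq (u : ℤˣ) (x : V) : u • x = signHom K u • x := by
  rw [signHom_apply, Units.smul_def, Int.cast_smul_eq_zsmul]

lemma signHom_mul_self (u : ℤˣ) : signHom K u * signHom K u = 1 := by
  rw [← map_mul, Int.units_mul_self, map_one]

lemma signHom_smul_smul_self (u : ℤˣ) (x : V) : signHom K u • signHom K u • x = x := by
  rw [smul_smul, signHom_mul_self, one_smul]

variable (𝓥 : ℤ → Submodule K V) [DirectSum.Decomposition 𝓥]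

lemma linearMap_ext_homogeneous {f g : V →ₗ[K] W} (h : ∀ i, ∀ x ∈ 𝓥 i, f x = g x) : f = g := by
  ext x
  induction x using DirectSum.Decomposition.inductionOn 𝓥 with
  | zero => simp
  | homogeneous x => exact h _ _ x.2
  | add x y hx hy => rw [map_add, map_add, hx, hy]

lemma koszulTwist_of_mem (p : ℤ) {i : ℤ} {x : V} (hx : x ∈ 𝓥 i) :
    koszulTwist 𝓥 p x = signHom K (Int.negOnePow (p * i)) • x := by
  simp only [koszulTwist, LinearMap.comp_apply, LinearEquiv.coe_coe,
    DirectSum.decomposeLinearEquiv_apply, DirectSum.decompose_of_mem 𝓥 hx]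
  rw [DirectSum.lmap_of, DirectSum.coeLinearMap_of]
  rfl

lemma koszulTwist_koszulTwist (p q : ℤ) (x : V) :
    koszulTwist 𝓥 p (koszulTwist 𝓥 q x) = koszulTwist 𝓥 (p + q) x := by
  have : koszulTwist 𝓥 p ∘ₗ koszulTwist 𝓥 q = koszulTwist 𝓥 (p + q) := by
    refine linearMap_ext_homogeneous 𝓥 fun i x hx => ?_
    rw [LinearMap.comp_apply, koszulTwist_of_mem 𝓥 _ hx, map_smul, koszulTwist_of_mem 𝓥 _ hx,
      koszulTwist_of_mem 𝓥 _ hx, smul_smul, ← map_mul, ← Int.negOnePow_add, add_mul, add_comm]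
  exact DFunLike.congr_fun this x

lemma koszulTwist_comm_self (p q : ℤ) (x : V) :
    koszulTwist 𝓥 p (koszulTwist 𝓥 q x) = koszulTwist 𝓥 q (koszulTwist 𝓥 p x) := by
  rw [koszulTwist_koszulTwist, koszulTwist_koszulTwist, add_comm]

lemma koszulTwist_self (p : ℤ) (x : V) : koszulTwist 𝓥 p (koszulTwist 𝓥 p x) = x := by
  have : koszulTwist 𝓥 p ∘ₗ koszulTwist 𝓥 p = LinearMap.id := by
    refine linearMap_ext_homogeneous 𝓥 fun i x hx => ?_
    rw [LinearMap.comp_apply, koszulTwist_of_mem 𝓥 _ hx, map_smul, koszulTwist_of_mem 𝓥 _ hx,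
      signHom_smul_smul_self, LinearMap.id_apply]
  exact DFunLike.congr_fun this x

/-- Encoding `(-1)^{p|x|}` as a linear operator allows Koszul sign computations without choosing
homogeneous elements; this commutation rule does most of that work later. -/
lemma HasDegree.koszulTwist_apply (𝓦 : ℤ → Submodule K W) [DirectSum.Decomposition 𝓦] {r : ℤ}
    {f : V →ₗ[K] W} (hf : HasDegree 𝓥 𝓦 r f) (p : ℤ) (x : V) :
    koszulTwist 𝓦 p (f x) = signHom K (Int.negOnePow (p * r)) • f (koszulTwist 𝓥 p x) := by
  have : koszulTwist 𝓦 p ∘ₗ f = signHom K (Int.negOnePow (p * r)) • (f ∘ₗ koszulTwist 𝓥 p) := by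
    refine linearMap_ext_homogeneous 𝓥 fun i x hx => ?_
    rw [LinearMap.comp_apply, koszulTwist_of_mem 𝓦 _ (hf i x hx), LinearMap.smul_apply,
      LinearMap.comp_apply, koszulTwist_of_mem 𝓥 _ hx, map_smul, smul_smul, ← map_mul,
      ← Int.negOnePow_add, mul_add, add_comm]
  exact DFunLike.congr_fun this x

end Twist

section Degree

variable {K V W U : Type*} [Field K] [AddCommGroup V] [Module K V] [AddCommGroup W] [Module K W]
  [AddCommGroup U] [Module K U] {𝓥 : ℤ → Submodule K V} {𝓦 : ℤ → Submodule K W}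
  {𝓤 : ℤ → Submodule K U}

lemma HasDegree.comp {r s t : ℤ} {f : V →ₗ[K] W} {g : W →ₗ[K] U} (hg : HasDegree 𝓦 𝓤 s g)
    (hf : HasDegree 𝓥 𝓦 r f) (h : r + s = t) : HasDegree 𝓥 𝓤 t (g ∘ₗ f) := fun i x hx => by
  have := hg _ _ (hf i x hx)
  rwa [add_assoc, h] at this

lemma HasDegree.pow {f : V →ₗ[K] V} (hf : HasDegree 𝓥 𝓥 0 f) (n : ℕ) :
    HasDegree 𝓥 𝓥 0 (f ^ n) := by
  induction n with
  | zero => intro i x hx; simpa using hx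
  | succ n ih => exact ih.comp hf (add_zero 0)

end Degree

/-! ### Recursive description of `SV` and of its coproduct. -/

namespace GSym

variable {K V : Type*} [Field K] [AddCommGroup V] [Module K V] (𝓥 : ℤ → Submodule K V)

lemma map_ι (α : V →ₗ[K] V) (hα : HasDegree 𝓥 𝓥 0 α) (v : V) :
    map 𝓥 α hα (ι 𝓥 v) = ι 𝓥 (α v) := lift_ι _ _ _ _

lemma map_wedge (α : V →ₗ[K] V) (hα : HasDegree 𝓥 𝓥 0 α) {n : ℕ} (v : Fin n → V) :
    map 𝓥 α hα (wedge 𝓥 v) = wedge 𝓥 (fun t => α (v t)) := by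
  induction n with
  | zero => simp [wedge_zero]
  | succ n ih => rw [wedge_succ, wedge_succ, map_mul, map_ι, ih]

lemma map_pow (α : V →ₗ[K] V) (hα : HasDegree 𝓥 𝓥 0 α) (n : ℕ) :
    map 𝓥 α hα ^ n = map 𝓥 (α ^ n) (hα.pow n) := by
  refine algHom_ext fun v => ?_
  rw [map_ι]
  induction n generalizing v with
  | zero => simp
  | succ n ih => rw [pow_succ, AlgHom.mul_apply, map_ι, ih, pow_succ, Module.End.mul_apply]

lemma proj_ι (v : V) : proj 𝓥 (ι 𝓥 v) = v :=
  TensorAlgebra.ι_leftInverse v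

lemma proj_ι_mul_ι_mul (v w : V) (x : GSym 𝓥) : proj 𝓥 (ι 𝓥 v * (ι 𝓥 w * x)) = 0 := by
  obtain ⟨x, rfl⟩ := mk_surjective 𝓥 x
  change TensorAlgebra.ιInv (TensorAlgebra.ι K v * (TensorAlgebra.ι K w * x)) = 0
  simp [TensorAlgebra.ιInv]

lemma wedge_mem_symPow {n : ℕ} (v : Fin n → V) : wedge 𝓥 v ∈ symPow 𝓥 n :=
  Submodule.subset_span ⟨v, rfl⟩

/-- The multilinear map `v₁, …, vₙ ↦ v₁ ∧ ⋯ ∧ vₙ`. -/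
def wedgeMultilinear (n : ℕ) : MultilinearMap K (fun _ : Fin n => V) (GSym 𝓥) :=
  (MultilinearMap.mkPiAlgebraFin K n (GSym 𝓥)).compLinearMap fun _ => ι 𝓥

lemma wedgeMultilinear_apply {n : ℕ} (v : Fin n → V) : wedgeMultilinear 𝓥 n v = wedge 𝓥 v := by
  simp [wedgeMultilinear, wedge]

section Decomposition

variable [DirectSum.Decomposition 𝓥]

lemma induction_ι_mul {P : GSym 𝓥 → Prop} (one : P 1) (zero : P 0)
    (add : ∀ x y, P x → P y → P (x + y)) (smul : ∀ (c : K) x, P x → P (c • x))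
    (mul : ∀ i, ∀ v ∈ 𝓥 i, ∀ x, P x → P (ι 𝓥 v * x)) (x : GSym 𝓥) : P x := by
  -- Quantifying over the right factor `x` makes the product case of the tensor algebra induction a
  -- mere composition.
  suffices h : ∀ a x, P x → P (a * x) by simpa using h x 1 one
  intro a
  obtain ⟨a, rfl⟩ := mk_surjective 𝓥 a
  induction a using TensorAlgebra.induction with
  | algebraMap r =>
    intro x hx
    rw [AlgHom.commutes, ← Algebra.smul_def]
    exact smul r x hx
  | ι v =>
    change ∀ x, P x → P (ι 𝓥 v * x)
    induction v using DirectSum.Decomposition.inductionOn 𝓥 with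
    | zero => intro x _; simpa using zero
    | homogeneous v => exact mul _ v v.2
    | add v w hv hw =>
      intro x hx
      rw [map_add, add_mul]
      exact add _ _ (hv x hx) (hw x hx)
  | mul a b ha hb =>
    intro x hx
    rw [map_mul, mul_assoc]
    exact ha _ (hb _ hx)
  | add a b ha hb =>
    intro x hx
    rw [map_add, add_mul]
    exact add _ _ (ha _ hx) (hb _ hx)

omit [DirectSum.Decomposition 𝓥] in
lemma map_hasDegree (α : V →ₗ[K] V) (hα : HasDegree 𝓥 𝓥 0 α) :
    HasDegree (deg 𝓥) (deg 𝓥) 0 (map 𝓥 α hα).toLinearMap := by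
  intro i x hx
  rw [add_zero]
  induction hx using Submodule.span_induction with
  | mem x h =>
    obtain ⟨n, d, v, hv, rfl, rfl⟩ := h
    rw [AlgHom.toLinearMap_apply, map_wedge]
    refine wedge_mem_deg 𝓥 fun t => ?_
    have := hα _ _ (hv t)
    rwa [add_zero] at this
  | zero => rw [map_zero]; exact zero_mem _
  | add x y _ _ hx hy => rw [map_add]; exact add_mem hx hy
  | smul c x _ hx => rw [map_smul]; exact Submodule.smul_mem _ _ hx

lemma koszulTwist_one (p : ℤ) : koszulTwist (deg 𝓥) p 1 = 1 := by
  rw [koszulTwist_of_mem (deg 𝓥) p (i := 0) SetLike.GradedOne.one_mem]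
  simp

omit [DirectSum.Decomposition 𝓥] in
lemma mulLeft_hasDegree {i : ℤ} {v : V} (hv : v ∈ 𝓥 i) :
    HasDegree (deg 𝓥) (deg 𝓥) i (LinearMap.mulLeft K (ι 𝓥 v)) := fun j x hx => by
  rw [add_comm]
  exact SetLike.GradedMul.mul_mem (ι_mem_deg 𝓥 hv) hx

lemma koszulTwist_ι_mul (p : ℤ) {i : ℤ} {v : V} (hv : v ∈ 𝓥 i) (x : GSym 𝓥) :
    koszulTwist (deg 𝓥) p (ι 𝓥 v * x) =
      signHom K (Int.negOnePow (p * i)) • (ι 𝓥 v * koszulTwist (deg 𝓥) p x) :=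
  (mulLeft_hasDegree 𝓥 hv).koszulTwist_apply (deg 𝓥) (deg 𝓥) p x

/-- Multiplication by `v ⊗ 1 + 1 ⊗ v` on `SV ⊗ SV`, for `v` of degree `i`. -/
def primitiveMul (i : ℤ) (v : V) : GSym 𝓥 ⊗[K] GSym 𝓥 →ₗ[K] GSym 𝓥 ⊗[K] GSym 𝓥 :=
  TensorProduct.map (LinearMap.mulLeft K (ι 𝓥 v)) LinearMap.id +
    TensorProduct.map (koszulTwist (deg 𝓥) i) (LinearMap.mulLeft K (ι 𝓥 v))

lemma primitiveMul_tmul (i : ℤ) (v : V) (x y : GSym 𝓥) : primitiveMul 𝓥 i v (x ⊗ₜ y) =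
    (ι 𝓥 v * x) ⊗ₜ y + koszulTwist (deg 𝓥) i x ⊗ₜ (ι 𝓥 v * y) := rfl

open GradedTensorProduct in
lemma of_symm_primitive_mul {i : ℤ} {v : V} (hv : v ∈ 𝓥 i) (w : GSym 𝓥 ⊗[K] GSym 𝓥) :
    (of K (deg 𝓥) (deg 𝓥)).symm (primitive 𝓥 v * of K (deg 𝓥) (deg 𝓥) w) =
      primitiveMul 𝓥 i v w := by
  induction w using TensorProduct.induction_on with
  | zero => simp
  | add w w' h h' => rw [map_add, mul_add, map_add, h, h', map_add]
  | tmul a b =>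
    induction a using DirectSum.Decomposition.inductionOn (deg 𝓥) with
    | zero => simp
    | add a a' h h' => rw [TensorProduct.add_tmul, map_add, mul_add, map_add, h, h', map_add]
    | @homogeneous j a =>
      have e : primitive 𝓥 v = tmul K (ι 𝓥 v) 1 + tmul K 1 (ι 𝓥 v) := rfl
      have h1 := tmul_one_mul_coe_tmul (deg 𝓥) (deg 𝓥) (R := K) (ι 𝓥 v) a b
      have h2 := tmul_coe_mul_coe_tmul (deg 𝓥) (deg 𝓥) (R := K) 1 ⟨_, ι_mem_deg 𝓥 hv⟩ a b
      rw [one_mul, units_smul_eq (K := K)] at h2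
      have h3 := congrArg₂ (· + ·) h1 h2
      rw [e, add_mul, primitiveMul_tmul, koszulTwist_of_mem (deg 𝓥) _ a.2,
        ← TensorProduct.smul_tmul']
      exact congrArg (of K (deg 𝓥) (deg 𝓥)).symm h3

/-- Multiplicativity of the coproduct, moved from the graded tensor product to the ordinary one. All
inductions on word length rest on this recursion. -/
lemma comul_ι_mul {i : ℤ} {v : V} (hv : v ∈ 𝓥 i) (x : GSym 𝓥) :
    comul 𝓥 (ι 𝓥 v * x) = primitiveMul 𝓥 i v (comul 𝓥 x) := by
  rw [← of_symm_primitive_mul 𝓥 hv]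
  change (GradedTensorProduct.of K (deg 𝓥) (deg 𝓥)).symm (comulAlgHom 𝓥 (ι 𝓥 v * x)) = _
  rw [map_mul]
  congr 2
  exact lift_ι _ _ _ _

lemma comul_one : comul 𝓥 1 = 1 ⊗ₜ[K] 1 := by
  change (GradedTensorProduct.of K (deg 𝓥) (deg 𝓥)).symm (comulAlgHom 𝓥 1) = _
  rw [map_one]
  rfl

lemma comul_map (α : V →ₗ[K] V) (hα : HasDegree 𝓥 𝓥 0 α) (x : GSym 𝓥) :
    comul 𝓥 (map 𝓥 α hα x) =
      TensorProduct.map (map 𝓥 α hα).toLinearMap (map 𝓥 α hα).toLinearMap (comul 𝓥 x) := by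
  induction x using induction_ι_mul 𝓥 with
  | one => simp [comul_one]
  | zero => simp
  | add x y hx hy => simp only [map_add, hx, hy]
  | smul c x hx => simp only [map_smul, hx]
  | mul i v hv x hx =>
    have hv' := hα i v hv
    rw [add_zero] at hv'
    rw [map_mul, map_ι, comul_ι_mul 𝓥 hv', comul_ι_mul 𝓥 hv, hx]
    generalize comul 𝓥 x = w
    induction w using TensorProduct.induction_on with
    | zero => simp
    | add w w' h h' => simp only [map_add, h, h']
    | tmul a b =>
      have := (map_hasDegree 𝓥 α hα).koszulTwist_apply (deg 𝓥) (deg 𝓥) i a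
      simp only [mul_zero, Int.negOnePow_zero, map_one, one_smul, AlgHom.toLinearMap_apply] at this
      simp [primitiveMul_tmul, map_ι, this]

end Decomposition

end GSym

/-! ### The explicit twisted lift and its coderivation property. -/

namespace GSym

variable {K V W : Type*} [Field K] [AddCommGroup V] [Module K V] [AddCommGroup W] [Module K W]
  (𝓥 : ℤ → Submodule K V) [DirectSum.Decomposition 𝓥]

lemma linearMap_ext_wedge {f g : GSym 𝓥 →ₗ[K] W}
    (h : ∀ (n : ℕ) (d : Fin n → ℤ) (v : Fin n → V), (∀ t, v t ∈ 𝓥 (d t)) →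
      f (wedge 𝓥 v) = g (wedge 𝓥 v)) : f = g := by
  refine linearMap_ext_homogeneous (deg 𝓥) fun i x hx => ?_
  induction hx using Submodule.span_induction with
  | mem x hx =>
    obtain ⟨n, d, v, hv, rfl, rfl⟩ := hx
    exact h n d v hv
  | zero => simp
  | add x y _ _ hx hy => rw [map_add, map_add, hx, hy]
  | smul c x _ hx => rw [map_smul, map_smul, hx]

/-- The map `x ↦ ∑ ρ(x₁) ∧ γ(x₂)`, where `△ x = ∑ x₁ ⊗ x₂`. -/
def twistedLift (γ : V →ₗ[K] V) (hγ : HasDegree 𝓥 𝓥 0 γ) (ρ : GSym 𝓥 →ₗ[K] V) :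
    GSym 𝓥 →ₗ[K] GSym 𝓥 :=
  LinearMap.mul' K (GSym 𝓥) ∘ₗ TensorProduct.map (ι 𝓥 ∘ₗ ρ) (map 𝓥 γ hγ).toLinearMap ∘ₗ comul 𝓥

variable (γ : V →ₗ[K] V) (hγ : HasDegree 𝓥 𝓥 0 γ)

lemma twistedLift_one (ρ : GSym 𝓥 →ₗ[K] V) : twistedLift 𝓥 γ hγ ρ 1 = ι 𝓥 (ρ 1) := by
  simp [twistedLift, comul_one]

/-- In `△(v ∧ x)` the vector `v` joins either the factor fed to `ρ` or the factor fed to `γ`. In the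
second case `γ v` must move left past `ρ(a)`: the signs `(-1)^{i|a|}` and `(-1)^{i(|a|+p)}` combine
to `(-1)^{pi}`. -/
lemma twistedLift_ι_mul {p : ℤ} {ρ : GSym 𝓥 →ₗ[K] V} (hρ : HasDegree (deg 𝓥) 𝓥 p ρ)
    {i : ℤ} {v : V} (hv : v ∈ 𝓥 i) (x : GSym 𝓥) :
    twistedLift 𝓥 γ hγ ρ (ι 𝓥 v * x) =
      twistedLift 𝓥 γ hγ (ρ ∘ₗ LinearMap.mulLeft K (ι 𝓥 v)) x +
        signHom K (Int.negOnePow (p * i)) • (ι 𝓥 (γ v) * twistedLift 𝓥 γ hγ ρ x) := by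
  have hγv := hγ i v hv
  rw [add_zero] at hγv
  have key : ∀ a : GSym 𝓥, ι 𝓥 (ρ (koszulTwist (deg 𝓥) i a)) * ι 𝓥 (γ v) =
      signHom K (Int.negOnePow (p * i)) • (ι 𝓥 (γ v) * ι 𝓥 (ρ a)) := by
    intro a
    induction a using DirectSum.Decomposition.inductionOn (deg 𝓥) with
    | zero => simp
    | add a b ha hb => simp only [map_add, add_mul, mul_add, ha, hb, smul_add]
    | @homogeneous j a =>
      rw [koszulTwist_of_mem (deg 𝓥) _ a.2, map_smul, map_smul, smul_mul_assoc,
        ι_mul_ι 𝓥 (hρ _ _ a.2) hγv, units_smul_eq (K := K), smul_smul, ← map_mul,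
        ← Int.negOnePow_add, add_mul, ← add_assoc, mul_comm j i, Int.negOnePow_add,
        Int.negOnePow_add, Int.units_mul_self, one_mul]
  simp only [twistedLift, LinearMap.comp_apply, comul_ι_mul 𝓥 hv]
  generalize comul 𝓥 x = w
  induction w using TensorProduct.induction_on with
  | zero => simp
  | add w w' h h' => simp only [map_add, h, h', mul_add, smul_add]; abel
  | tmul a b =>
    simp only [primitiveMul_tmul, map_add, TensorProduct.map_tmul, LinearMap.comp_apply,
      LinearMap.mul'_apply, AlgHom.toLinearMap_apply, map_mul, map_ι, LinearMap.mulLeft_apply]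
    rw [← mul_assoc (ι 𝓥 (ρ _)), key, smul_mul_assoc, mul_assoc]

omit [DirectSum.Decomposition 𝓥] in
lemma comp_mulLeft_hasDegree {p : ℤ} {ρ : GSym 𝓥 →ₗ[K] V} (hρ : HasDegree (deg 𝓥) 𝓥 p ρ)
    {i : ℤ} {v : V} (hv : v ∈ 𝓥 i) :
    HasDegree (deg 𝓥) 𝓥 (i + p) (ρ ∘ₗ LinearMap.mulLeft K (ι 𝓥 v)) :=
  hρ.comp (mulLeft_hasDegree 𝓥 hv) rfl

lemma twistedLift_hasDegree {p : ℤ} {ρ : GSym 𝓥 →ₗ[K] V} (hρ : HasDegree (deg 𝓥) 𝓥 p ρ) :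
    HasDegree (deg 𝓥) (deg 𝓥) p (twistedLift 𝓥 γ hγ ρ) := by
  intro i x hx
  induction hx using Submodule.span_induction with
  | zero => rw [map_zero]; exact zero_mem _
  | add x y _ _ hx hy => rw [map_add]; exact add_mem hx hy
  | smul c x _ hx => rw [map_smul]; exact Submodule.smul_mem _ _ hx
  | mem x hx =>
    obtain ⟨n, d, v, hv, rfl, rfl⟩ := hx
    induction n generalizing p ρ with
    | zero =>
      rw [wedge_zero, twistedLift_one]
      refine ι_mem_deg 𝓥 (hρ _ _ ?_)
      rw [← wedge_zero 𝓥 v]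
      exact wedge_mem_deg 𝓥 hv
    | succ n ih =>
      rw [wedge_succ, twistedLift_ι_mul 𝓥 γ hγ hρ (hv 0), Fin.sum_univ_succ]
      refine add_mem ?_ (Submodule.smul_mem _ _ ?_)
      · have := ih (comp_mulLeft_hasDegree 𝓥 hρ (hv 0)) (fun t => d t.succ) (fun t => v t.succ)
          fun t => hv t.succ
        rwa [← add_assoc, add_comm _ (d 0)] at this
      · have h1 := hγ _ _ (hv 0)
        rw [add_zero] at h1
        rw [add_assoc]
        exact SetLike.GradedMul.mul_mem (ι_mem_deg 𝓥 h1)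
          (ih hρ (fun t => d t.succ) (fun t => v t.succ) fun t => hv t.succ)

lemma proj_twistedLift {p : ℤ} {ρ : GSym 𝓥 →ₗ[K] V} (hρ : HasDegree (deg 𝓥) 𝓥 p ρ)
    (x : GSym 𝓥) : proj 𝓥 (twistedLift 𝓥 γ hγ ρ x) = ρ x := by
  induction x using induction_ι_mul 𝓥 generalizing p ρ with
  | one => rw [twistedLift_one, proj_ι]
  | zero => simp
  | add x y hx hy => simp only [map_add, hx hρ, hy hρ]
  | smul c x hx => simp only [map_smul, hx hρ]
  | mul i v hv x hx =>
    have h0 : ∀ w, proj 𝓥 (ι 𝓥 w * twistedLift 𝓥 γ hγ ρ x) = 0 := by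
      intro w
      simp only [twistedLift, LinearMap.comp_apply]
      generalize comul 𝓥 x = z
      induction z using TensorProduct.induction_on with
      | zero => simp
      | add z z' h h' => simp only [map_add, mul_add, h, h', add_zero]
      | tmul a b =>
        simp only [TensorProduct.map_tmul, LinearMap.mul'_apply, LinearMap.comp_apply,
          proj_ι_mul_ι_mul]
    rw [twistedLift_ι_mul 𝓥 γ hγ hρ hv, map_add, map_smul, h0, smul_zero, add_zero,
      hx (comp_mulLeft_hasDegree 𝓥 hρ hv)]
    rfl

lemma map_twistedLift {α : V →ₗ[K] V} (hα : HasDegree 𝓥 𝓥 0 α) (hc : Commute α γ)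
    {ρ : GSym 𝓥 →ₗ[K] V} (h : ∀ x, α (ρ x) = ρ (map 𝓥 α hα x)) (x : GSym 𝓥) :
    map 𝓥 α hα (twistedLift 𝓥 γ hγ ρ x) = twistedLift 𝓥 γ hγ ρ (map 𝓥 α hα x) := by
  have hm : ∀ y, map 𝓥 α hα (map 𝓥 γ hγ y) = map 𝓥 γ hγ (map 𝓥 α hα y) := by
    intro y
    have : (map 𝓥 α hα).comp (map 𝓥 γ hγ) = (map 𝓥 γ hγ).comp (map 𝓥 α hα) := by
      refine algHom_ext fun v => ?_
      simp only [AlgHom.comp_apply, map_ι]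
      exact congrArg _ (LinearMap.congr_fun hc.eq v)
    exact DFunLike.congr_fun this y
  simp only [twistedLift, LinearMap.comp_apply, comul_map]
  generalize comul 𝓥 x = w
  induction w using TensorProduct.induction_on with
  | zero => simp
  | add w w' h h' => simp only [map_add, h, h']
  | tmul a b => simp [map_ι, h, hm]

/-- The induction on words must let `ρ` and `p` vary, because removing a first letter `v` of degree
`i` replaces `ρ` by `ρ(v ∧ ·)`, of degree `i + p`. For the same reason `ρ` is not assumed to be
supported on a single `SⁿV`. -/
lemma comul_twistedLift {p : ℤ} {ρ : GSym 𝓥 →ₗ[K] V} (hρ : HasDegree (deg 𝓥) 𝓥 p ρ)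
    (x : GSym 𝓥) :
    comul 𝓥 (twistedLift 𝓥 γ hγ ρ x) =
      TensorProduct.map (twistedLift 𝓥 γ hγ ρ) (map 𝓥 γ hγ).toLinearMap (comul 𝓥 x) +
        TensorProduct.map ((map 𝓥 γ hγ).toLinearMap ∘ₗ koszulTwist (deg 𝓥) p)
          (twistedLift 𝓥 γ hγ ρ) (comul 𝓥 x) := by
  induction x using induction_ι_mul 𝓥 generalizing p ρ with
  | zero => simp
  | add x y hx hy => simp only [map_add, hx hρ, hy hρ]; abel
  | smul c x hx => simp only [map_smul, hx hρ, smul_add]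
  | one =>
    have h0 : ρ 1 ∈ 𝓥 (0 + p) := hρ 0 1 SetLike.GradedOne.one_mem
    have := comul_ι_mul 𝓥 h0 1
    rw [mul_one, comul_one, primitiveMul_tmul, mul_one, koszulTwist_one] at this
    rw [twistedLift_one, this, comul_one]
    simp [twistedLift_one, koszulTwist_one]
  | mul i v hv x hx =>
    have hγv := hγ i v hv
    rw [add_zero] at hγv
    rw [twistedLift_ι_mul 𝓥 γ hγ hρ hv, map_add, map_smul, comul_ι_mul 𝓥 hγv, comul_ι_mul 𝓥 hv,
      hx hρ, hx (comp_mulLeft_hasDegree 𝓥 hρ hv)]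
    generalize comul 𝓥 x = w
    induction w using TensorProduct.induction_on with
    | zero => simp
    | add w w' h h' =>
      refine Eq.trans ?_ ((congrArg₂ (· + ·) h h').trans ?_) <;>
        simp only [map_add, smul_add] <;> abel
    | tmul a b =>
      have h1 := (map_hasDegree 𝓥 γ hγ).koszulTwist_apply (deg 𝓥) (deg 𝓥) i
      simp only [mul_zero, Int.negOnePow_zero, map_one, one_smul, AlgHom.toLinearMap_apply] at h1
      have h2 := (twistedLift_hasDegree 𝓥 γ hγ hρ).koszulTwist_apply (deg 𝓥) (deg 𝓥) i
      have h3 := koszulTwist_ι_mul 𝓥 p hv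
      have h4 := twistedLift_ι_mul 𝓥 γ hγ hρ hv
      simp only [primitiveMul_tmul, map_add, TensorProduct.map_tmul, LinearMap.comp_apply,
        AlgHom.toLinearMap_apply, map_mul, map_ι, h1, h2, h3, h4, map_smul,
        ← koszulTwist_koszulTwist, TensorProduct.add_tmul,
        TensorProduct.tmul_add, TensorProduct.tmul_smul, ← TensorProduct.smul_tmul', smul_add]
      rw [koszulTwist_comm_self (deg 𝓥) p i, mul_comm i p, signHom_smul_smul_self]
      abel

end GSym

/-! ### Reordering products of elements that commute up to sign. -/

section Koszul

variable {A : Type*} [Ring A]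

lemma mul_prod_ofFn_succAbove {n : ℕ} (g : Fin (n + 1) → A) (e : Fin (n + 1) → ℤ)
    (hc : ∀ s t, s ≠ t → g s * g t = Int.negOnePow (e s * e t) • (g t * g s)) (p : Fin (n + 1)) :
    g p * (List.ofFn fun t => g (p.succAbove t)).prod =
      (∏ t, if t < p then Int.negOnePow (e t * e p) else 1) • (List.ofFn g).prod := by
  induction n with
  | zero =>
    obtain rfl : p = 0 := Fin.ext (by omega)
    simp
  | succ n ih =>
    induction p using Fin.cases with
    | zero => simp [List.ofFn_succ]
    | succ q =>
      have h1 := ih (fun t => g t.succ) (fun t => e t.succ)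
        (fun s t hst => hc _ _ (fun h => hst (Fin.succ_injective _ h))) q
      rw [List.ofFn_succ, List.prod_cons, ← mul_assoc, Fin.succAbove_ne_zero_zero (Fin.succ_ne_zero q),
        hc _ _ (Fin.succ_ne_zero q), smul_mul_assoc, mul_assoc]
      simp only [Fin.succ_succAbove_succ]
      rw [h1, mul_smul_comm, smul_smul, List.ofFn_succ (f := g), List.prod_cons,
        Fin.prod_univ_succ fun t => if t < q.succ then Int.negOnePow (e t * e q.succ) else 1]
      simp [mul_comm (e q.succ)]

/-- The permutation of `Fin n` obtained from a permutation of `Fin (n + 1)` by deleting `0` and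
the position where it is attained. -/
lemma exists_perm_deleteZero {n : ℕ} (σ : Equiv.Perm (Fin (n + 1))) :
    ∃ (p : Fin (n + 1)) (τ : Equiv.Perm (Fin n)), σ p = 0 ∧
      ∀ t, σ (p.succAbove t) = (τ t).succ := by
  obtain ⟨p, hp⟩ := σ.surjective 0
  have hne : ∀ t, σ (p.succAbove t) ≠ 0 := fun t h =>
    Fin.succAbove_ne p t (σ.injective (h.trans hp.symm))
  have hinj : Function.Injective fun t => (σ (p.succAbove t)).pred (hne t) := by
    intro s t hst
    rw [Fin.pred_inj] at hst
    exact Fin.succAbove_right_injective (σ.injective hst)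
  exact ⟨p, Equiv.ofBijective _ (Finite.injective_iff_bijective.1 hinj), hp, fun t => by simp⟩

/-- The value `0` sits at position `p` and is the smallest, so it is inverted with exactly the
positions before `p`. All other inversions of `σ` are those of `τ`. -/
lemma koszulSign_succ {n : ℕ} {σ : Equiv.Perm (Fin (n + 1))} {p : Fin (n + 1)}
    {τ : Equiv.Perm (Fin n)} (hp : σ p = 0) (hτ : ∀ t, σ (p.succAbove t) = (τ t).succ)
    (d : Fin (n + 1) → ℤ) :
    koszulSign σ d = koszulSign τ (fun t => d t.succ) *
      ∏ t, if t < p then Int.negOnePow (d (σ t) * d (σ p)) else 1 := by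
  rw [koszulSign, Fin.prod_univ_succAbove _ p]
  simp only [hp, Fin.not_lt_zero, and_false, if_false, Finset.prod_const_one, one_mul]
  simp_rw [fun x : Fin n => Fin.prod_univ_succAbove (fun q => if p.succAbove x < q ∧
    σ q < σ (p.succAbove x) then Int.negOnePow (d (σ (p.succAbove x)) * d (σ q)) else 1) p]
  rw [Finset.prod_mul_distrib, mul_comm, Fin.prod_univ_succAbove _ p]
  simp only [hp, hτ, Fin.succ_lt_succ_iff, Fin.succ_pos, and_true, lt_irrefl, if_false, one_mul,
    (Fin.strictMono_succAbove p).lt_iff_lt]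
  rfl

/-- Stated for an arbitrary ring because it serves both `SV` and the graded tensor product `SV ⊗
SV`. The induction moves the first factor of the original product to the front of the permuted one.
-/
lemma prod_ofFn_perm {n : ℕ} (h : Fin n → A) (d : Fin n → ℤ)
    (hc : ∀ s t, s ≠ t → h s * h t = Int.negOnePow (d s * d t) • (h t * h s))
    (σ : Equiv.Perm (Fin n)) :
    (List.ofFn h).prod = koszulSign σ d • (List.ofFn fun t => h (σ t)).prod := by
  induction n with
  | zero => simp [koszulSign]
  | succ n ih =>
    obtain ⟨p, τ, hp, hτ⟩ := exists_perm_deleteZero σ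
    have h1 := mul_prod_ofFn_succAbove (fun t => h (σ t)) (fun t => d (σ t))
      (fun s t hst => hc _ _ fun e => hst (σ.injective e)) p
    rw [koszulSign_succ hp hτ, mul_smul, ← h1, List.ofFn_succ, List.prod_cons,
      ih (fun t => h t.succ) (fun t => d t.succ)
        (fun s t hst => hc _ _ fun e => hst (Fin.succ_injective _ e)) τ, mul_smul_comm]
    simp only [hp, hτ]

lemma koszulSign_one {n : ℕ} (d : Fin n → ℤ) : koszulSign 1 d = 1 := by
  refine Finset.prod_eq_one fun p _ => Finset.prod_eq_one fun q _ => if_neg ?_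
  rintro ⟨h1, h2⟩
  exact lt_asymm h1 h2

end Koszul

/-! ### Unshuffles as subsets of `Fin n`. -/

section Unshuffles

lemma mem_unshuffles {n i : ℕ} {σ : Equiv.Perm (Fin n)} : σ ∈ unshuffles n i ↔
    ∀ p q : Fin n, p < q → ((q : ℕ) < i ∨ i ≤ (p : ℕ)) → σ p < σ q := by
  simp [unshuffles]

lemma unshuffles_eq_singleton {n i : ℕ} (hi : i = 0 ∨ i = n) : unshuffles n i = {1} := by
  ext σ
  rw [mem_unshuffles, Finset.mem_singleton]
  constructor
  · intro h
    have hs : StrictMono σ := fun p q hpq => h p q hpq (by omega)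
    ext t : 1
    exact congrFun (hs.range_inj strictMono_id |>.1
      (σ.surjective.range_eq.trans Set.range_id.symm)) t
  · rintro rfl p q hpq _
    exact hpq

/-- The set of values of the first `i` entries of a permutation. -/
def firstValues {n : ℕ} (i : ℕ) (σ : Equiv.Perm (Fin n)) : Finset (Fin n) :=
  {u | (σ.symm u : ℕ) < i}

lemma mem_firstValues {n i : ℕ} {σ : Equiv.Perm (Fin n)} {u : Fin n} :
    u ∈ firstValues i σ ↔ (σ.symm u : ℕ) < i := by simp [firstValues]

lemma card_firstValues {n i : ℕ} (hi : i ≤ n) (σ : Equiv.Perm (Fin n)) :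
    (firstValues i σ).card = i := by
  have : firstValues i σ = (Finset.univ.map (Fin.castLEEmb hi)).map σ.toEmbedding := by
    ext u
    simp only [mem_firstValues, Finset.mem_map, Finset.mem_univ, true_and,
      exists_exists_eq_and, Equiv.coe_toEmbedding]
    constructor
    · intro h
      exact ⟨⟨_, h⟩, by simp [Fin.castLEEmb]⟩
    · rintro ⟨a, rfl⟩
      simp
  rw [this]
  simp

/-- Both blocks of an unshuffle are increasing, hence they are the unique increasing enumerations of
the set of first values and of its complement. -/
lemma unshuffles_ext {n i : ℕ} (hi : i ≤ n) {σ τ : Equiv.Perm (Fin n)} (hσ : σ ∈ unshuffles n i)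
    (hτ : τ ∈ unshuffles n i) (h : firstValues i σ = firstValues i τ) : σ = τ := by
  rw [mem_unshuffles] at hσ hτ
  have hc := card_firstValues hi τ
  have hc' : (firstValues i τ)ᶜ.card = n - i := by rw [Finset.card_compl, hc, Fintype.card_fin]
  have first : ∀ π : Equiv.Perm (Fin n), (∀ p q : Fin n, p < q → ((q : ℕ) < i ∨ i ≤ (p : ℕ)) →
      π p < π q) → firstValues i π = firstValues i τ → (fun t : Fin i => π ⟨t, by omega⟩) =
        (firstValues i τ).orderEmbOfFin hc := fun π hπ e =>
    Finset.orderEmbOfFin_unique hc (fun t => by rw [← e, mem_firstValues]; simp)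
      fun a b hab => hπ _ _ hab (Or.inl b.2)
  have last : ∀ π : Equiv.Perm (Fin n), (∀ p q : Fin n, p < q → ((q : ℕ) < i ∨ i ≤ (p : ℕ)) →
      π p < π q) → firstValues i π = firstValues i τ → (fun t : Fin (n - i) => π ⟨i + t, by omega⟩) =
        (firstValues i τ)ᶜ.orderEmbOfFin hc' := fun π hπ e =>
    Finset.orderEmbOfFin_unique hc' (fun t => by rw [← e, Finset.mem_compl, mem_firstValues]; simp)
      fun a b hab => hπ _ _ (Fin.mk_lt_mk.2 (Nat.add_lt_add_left hab i)) (Or.inr (by simp))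
  ext t : 1
  by_cases ht : (t : ℕ) < i
  · exact congrFun ((first σ hσ h).trans (first τ hτ rfl).symm) ⟨t, ht⟩
  · have := congrFun ((last σ hσ h).trans (last τ hτ rfl).symm) ⟨t - i, by omega⟩
    simpa [Nat.add_sub_of_le (not_lt.1 ht)] using this

lemma exists_unshuffle {n : ℕ} (s : Finset (Fin n)) :
    ∃ σ ∈ unshuffles n s.card, firstValues s.card σ = s := by
  have hle : s.card ≤ n := by simpa using s.card_le_univ
  have hc' : sᶜ.card = n - s.card := by rw [Finset.card_compl, Fintype.card_fin]
  let σ : Equiv.Perm (Fin n) := (finCongr (Nat.add_sub_of_le hle).symm).trans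
    (finSumFinEquiv.symm.trans (finSumEquivOfFinset rfl hc'))
  have h1 : ∀ t : Fin n, ∀ ht : (t : ℕ) < s.card, σ t = s.orderEmbOfFin rfl ⟨t, ht⟩ := by
    intro t ht
    have : finCongr (Nat.add_sub_of_le hle).symm t = Fin.castAdd _ ⟨t, ht⟩ := rfl
    simp only [σ, Equiv.trans_apply, this, finSumFinEquiv_symm_apply_castAdd,
      finSumEquivOfFinset_inl]
  have h2 : ∀ t : Fin n, ∀ ht : s.card ≤ (t : ℕ), σ t =
      sᶜ.orderEmbOfFin hc' ⟨t - s.card, by omega⟩ := by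
    intro t ht
    have : finCongr (Nat.add_sub_of_le hle).symm t = Fin.natAdd _ ⟨t - s.card, by omega⟩ := by
      ext; simp; omega
    simp only [σ, Equiv.trans_apply, this, finSumFinEquiv_symm_apply_natAdd,
      finSumEquivOfFinset_inr]
  refine ⟨σ, mem_unshuffles.2 ?_, ?_⟩
  · rintro p q hpq (h | h)
    · rw [h1 q h, h1 p (by omega)]
      exact (s.orderEmbOfFin rfl).strictMono hpq
    · rw [h2 p h, h2 q (by omega)]
      refine (sᶜ.orderEmbOfFin hc').strictMono ?_
      rw [Fin.mk_lt_mk]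
      omega
  · ext u
    obtain ⟨t, rfl⟩ := σ.surjective u
    rw [mem_firstValues, Equiv.symm_apply_apply]
    by_cases ht : (t : ℕ) < s.card
    · rw [h1 t ht]
      simp [ht]
    · rw [h2 t (not_lt.1 ht)]
      have := Finset.orderEmbOfFin_mem sᶜ hc' ⟨t - s.card, by omega⟩
      exact iff_of_false ht (Finset.mem_compl.1 this)

lemma sum_finset_eq_sum_unshuffles {n : ℕ} {M : Type*} [AddCommMonoid M]
    (F : Finset (Fin n) → M) :
    ∑ s, F s = ∑ i : Fin (n + 1), ∑ σ ∈ unshuffles n i, F (firstValues i σ) := by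
  rw [Finset.sum_sigma']
  symm
  refine Finset.sum_bij (fun x _ => firstValues x.1 x.2) (fun _ _ => Finset.mem_univ _) ?_ ?_
    fun _ _ => rfl
  · rintro ⟨i, σ⟩ hσ ⟨j, τ⟩ hτ h
    simp only [Finset.mem_sigma, Finset.mem_univ, true_and] at hσ hτ h
    have hij : i = j := by
      ext
      rw [← card_firstValues (Nat.lt_succ_iff.1 i.2) σ, h,
        card_firstValues (Nat.lt_succ_iff.1 j.2) τ]
    subst hij
    rw [unshuffles_ext (Nat.lt_succ_iff.1 i.2) hσ hτ h]
  · intro s _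
    obtain ⟨σ, hσ, h⟩ := exists_unshuffle s
    have hle : s.card ≤ n := by simpa using s.card_le_univ
    exact ⟨⟨⟨s.card, Nat.lt_succ_iff.2 hle⟩, σ⟩, by simpa using hσ, h⟩

end Unshuffles

section Multilinear

variable {K V W : Type*} [Field K] [AddCommGroup V] [Module K V] [AddCommGroup W] [Module K W]
  (𝓥 : ℤ → Submodule K V) [DirectSum.Decomposition 𝓥]

lemma multilinear_ext_homogeneous {n : ℕ} {f g : MultilinearMap K (fun _ : Fin n => V) W}
    (h : ∀ (d : Fin n → ℤ) (v : Fin n → V), (∀ t, v t ∈ 𝓥 (d t)) → f v = g v) : f = g := by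
  classical
  ext v
  have e : v = fun t => ∑ i ∈ (DirectSum.decompose 𝓥 (v t)).support,
      (DirectSum.decompose 𝓥 (v t) i : V) :=
    funext fun t => (DirectSum.sum_support_decompose 𝓥 (v t)).symm
  rw [e, MultilinearMap.map_sum_finset, MultilinearMap.map_sum_finset]
  exact Finset.sum_congr rfl fun r _ => h r _ fun t => SetLike.coe_mem _

end Multilinear

/-! ### The unshuffle formula, primitive elements, and rigidity of twisted coderivations. -/

namespace GSym

variable {K V W : Type*} [Field K] [AddCommGroup V] [Module K V] [AddCommGroup W] [Module K W]
  (𝓥 : ℤ → Submodule K V)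

lemma wedge_perm {n : ℕ} {d : Fin n → ℤ} {v : Fin n → V} (hv : ∀ t, v t ∈ 𝓥 (d t))
    (σ : Equiv.Perm (Fin n)) :
    wedge 𝓥 v = signHom K (koszulSign σ d) • wedge 𝓥 (fun t => v (σ t)) := by
  rw [← units_smul_eq]
  exact prod_ofFn_perm _ d (fun s t _ => ι_mul_ι 𝓥 (hv s) (hv t)) σ

lemma ι_mul_wedge {n m : ℕ} (h : n = m + 1) (v : Fin n → V) :
    wedge 𝓥 v = ι 𝓥 (v ⟨0, by omega⟩) * wedge 𝓥 fun t : Fin m => v ⟨t + 1, by omega⟩ := by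
  subst h
  exact wedge_succ 𝓥 v

lemma wedge_of_eq_zero {n : ℕ} (h : n = 0) (v : Fin n → V) : wedge 𝓥 v = 1 := by
  subst h
  exact wedge_zero 𝓥 v

variable [DirectSum.Decomposition 𝓥]

omit [DirectSum.Decomposition 𝓥] in
lemma wedge_one (v : Fin 1 → V) : wedge 𝓥 v = ι 𝓥 (v 0) := by
  rw [wedge_succ, wedge_zero, mul_one]

lemma symPow_le {n : ℕ} {P : Submodule K (GSym 𝓥)}
    (h : ∀ (d : Fin n → ℤ) (v : Fin n → V), (∀ t, v t ∈ 𝓥 (d t)) → wedge 𝓥 v ∈ P) :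
    symPow 𝓥 n ≤ P := by
  rw [symPow, Submodule.span_le]
  rintro _ ⟨v, rfl⟩
  have : P.mkQ.compMultilinearMap (wedgeMultilinear 𝓥 n) = 0 := by
    refine multilinear_ext_homogeneous 𝓥 fun d w hw => ?_
    rw [LinearMap.compMultilinearMap_apply, wedgeMultilinear_apply]
    exact (Submodule.Quotient.mk_eq_zero _).2 (h d w hw)
  have := DFunLike.congr_fun this v
  rw [LinearMap.compMultilinearMap_apply, wedgeMultilinear_apply] at this
  exact (Submodule.Quotient.mk_eq_zero _).1 this

lemma eq_top_of_symPow_le {P : Submodule K (GSym 𝓥)} (h : ∀ n, symPow 𝓥 n ≤ P) : P = ⊤ := by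
  rw [← Submodule.ker_mkQ P, LinearMap.ker_eq_top]
  refine linearMap_ext_wedge 𝓥 fun n d v _ => ?_
  exact (Submodule.Quotient.mk_eq_zero _).2 (h n (wedge_mem_symPow 𝓥 v))

section Comul

open GradedTensorProduct

omit [DirectSum.Decomposition 𝓥] in
lemma prod_ofFn_ι {A : Type*} [Ring A] [Algebra K A] (f : GSym 𝓥 →ₐ[K] A) {n : ℕ}
    (v : Fin n → V) : (List.ofFn fun t => f (ι 𝓥 (v t))).prod = f (wedge 𝓥 v) := by
  rw [wedge, map_list_prod, List.map_ofFn]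
  rfl

omit [DirectSum.Decomposition 𝓥] in
lemma prod_ofFn_split {A : Type*} [Ring A] [Algebra K A] (f g : GSym 𝓥 →ₐ[K] A) {n i m : ℕ}
    (h : i + m = n) (v : Fin n → V) :
    (List.ofFn fun t : Fin n => if (t : ℕ) < i then f (ι 𝓥 (v t)) else g (ι 𝓥 (v t))).prod =
      f (wedge 𝓥 fun t : Fin i => v ⟨t, by omega⟩) *
        g (wedge 𝓥 fun t : Fin m => v ⟨i + t, by omega⟩) := by
  subst h
  rw [← prod_ofFn_ι, ← prod_ofFn_ι, List.ofFn_add, List.prod_append]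
  simp
  rfl

lemma comul_wedge {n : ℕ} {d : Fin n → ℤ} {v : Fin n → V} (hv : ∀ t, v t ∈ 𝓥 (d t)) :
    comul 𝓥 (wedge 𝓥 v) = ∑ i : Fin (n + 1), ∑ σ ∈ unshuffles n i,
      signHom K (koszulSign σ d) •
        ((wedge 𝓥 fun t : Fin i => v (σ ⟨t, by omega⟩)) ⊗ₜ[K]
          (wedge 𝓥 fun t : Fin (n - i) => v (σ ⟨i + t, by omega⟩))) := by
  classical
  set f := includeLeft (R := K) (deg 𝓥) (deg 𝓥)
  set g := includeRight (R := K) (deg 𝓥) (deg 𝓥)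
  have hff : ∀ s t, f (ι 𝓥 (v s)) * f (ι 𝓥 (v t)) =
      Int.negOnePow (d s * d t) • (f (ι 𝓥 (v t)) * f (ι 𝓥 (v s))) := by
    intro s t
    rw [← map_mul, ι_mul_ι 𝓥 (hv s) (hv t), units_smul_eq (K := K), map_smul, map_mul,
      units_smul_eq (K := K)]
  have hgg : ∀ s t, g (ι 𝓥 (v s)) * g (ι 𝓥 (v t)) =
      Int.negOnePow (d s * d t) • (g (ι 𝓥 (v t)) * g (ι 𝓥 (v s))) := by
    intro s t
    rw [← map_mul, ι_mul_ι 𝓥 (hv s) (hv t), units_smul_eq (K := K), map_smul, map_mul,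
      units_smul_eq (K := K)]
  have hgf : ∀ s t, g (ι 𝓥 (v s)) * f (ι 𝓥 (v t)) =
      Int.negOnePow (d s * d t) • (f (ι 𝓥 (v t)) * g (ι 𝓥 (v s))) := by
    intro s t
    have h1 := tmul_one_mul_one_tmul (deg 𝓥) (deg 𝓥) (R := K) (ι 𝓥 (v t)) (ι 𝓥 (v s))
    have h2 := tmul_coe_mul_coe_tmul (deg 𝓥) (deg 𝓥) (R := K) 1 ⟨_, ι_mem_deg 𝓥 (hv s)⟩
      ⟨_, ι_mem_deg 𝓥 (hv t)⟩ 1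
    simp only [one_mul, mul_one] at h2
    rw [← h1] at h2
    exact h2
  have hfg : ∀ s t, f (ι 𝓥 (v s)) * g (ι 𝓥 (v t)) =
      Int.negOnePow (d s * d t) • (g (ι 𝓥 (v t)) * f (ι 𝓥 (v s))) := by
    intro s t
    rw [hgf, smul_smul, mul_comm (d t), Int.units_mul_self, one_smul]
  -- The product of the sums `v_t ⊗ 1 + 1 ⊗ v_t` expands over the subsets recording which letters go
  -- left. The unshuffle attached to a subset then gathers those letters in front, at the cost of
  -- its Koszul sign.
  have h1 : comulAlgHom 𝓥 (wedge 𝓥 v) = MultilinearMap.mkPiAlgebraFin K n _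
      ((fun t => f (ι 𝓥 (v t))) + fun t => g (ι 𝓥 (v t))) := by
    rw [← prod_ofFn_ι, MultilinearMap.mkPiAlgebraFin_apply]
    simp only [comulAlgHom, lift_ι]
    rfl
  change (of K (deg 𝓥) (deg 𝓥)).symm (comulAlgHom 𝓥 (wedge 𝓥 v)) = _
  rw [h1, MultilinearMap.map_add_univ, sum_finset_eq_sum_unshuffles, map_sum]
  refine Finset.sum_congr rfl fun i _ => ?_
  rw [map_sum]
  refine Finset.sum_congr rfl fun σ _ => ?_
  have hi : (i : ℕ) + (n - i) = n := by omega
  rw [MultilinearMap.mkPiAlgebraFin_apply, prod_ofFn_perm _ d ?_ σ, units_smul_eq (K := K),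
    map_smul]
  · congr 1
    have h2 := prod_ofFn_split 𝓥 f g hi (fun t => v (σ t))
    have h3 := tmul_one_mul_one_tmul (deg 𝓥) (deg 𝓥) (R := K)
      (wedge 𝓥 fun t : Fin i => v (σ ⟨t, by omega⟩))
      (wedge 𝓥 fun t : Fin (n - i) => v (σ ⟨i + t, by omega⟩))
    refine congrArg (of K (deg 𝓥) (deg 𝓥)).symm (Eq.trans ?_ (h2.trans h3))
    congr 2
    ext t
    simp only [Finset.piecewise, mem_firstValues, Equiv.symm_apply_apply]
  · intro s t _
    simp only [Finset.piecewise]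
    split_ifs
    exacts [hff s t, hfg s t, hgf s t, hgg s t]

end Comul

variable {p : ℤ}

/-- A linear map which vanishes on `SᵏV` for `k < n` sees only the term `x ⊗ 1` of the coproduct
of `x ∈ SⁿV`. -/
lemma map_comul_left {n : ℕ} {f g : GSym 𝓥 →ₗ[K] GSym 𝓥}
    (hf : ∀ k < n, ∀ x ∈ symPow 𝓥 k, f x = 0) {d : Fin n → ℤ} {v : Fin n → V}
    (hv : ∀ t, v t ∈ 𝓥 (d t)) :
    TensorProduct.map f g (comul 𝓥 (wedge 𝓥 v)) = f (wedge 𝓥 v) ⊗ₜ g 1 := by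
  rw [comul_wedge 𝓥 hv, map_sum, Finset.sum_eq_single (Fin.last n)]
  · rw [unshuffles_eq_singleton (Or.inr (Fin.val_last n)), Finset.sum_singleton, koszulSign_one,
      map_one, one_smul, TensorProduct.map_tmul,
      wedge_of_eq_zero 𝓥 (n := n - (Fin.last n : ℕ)) (by simp)]
    rfl
  · intro i _ hi
    rw [map_sum]
    refine Finset.sum_eq_zero fun σ _ => ?_
    rw [map_smul, TensorProduct.map_tmul, hf i (Fin.val_lt_last hi) _ (wedge_mem_symPow 𝓥 _),
      TensorProduct.zero_tmul, smul_zero]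
  · simp

lemma map_comul_right {n : ℕ} {f g : GSym 𝓥 →ₗ[K] GSym 𝓥}
    (hf : ∀ k < n, ∀ x ∈ symPow 𝓥 k, f x = 0) {d : Fin n → ℤ} {v : Fin n → V}
    (hv : ∀ t, v t ∈ 𝓥 (d t)) :
    TensorProduct.map g f (comul 𝓥 (wedge 𝓥 v)) = g 1 ⊗ₜ f (wedge 𝓥 v) := by
  rw [comul_wedge 𝓥 hv, map_sum, Finset.sum_eq_single 0]
  · rw [unshuffles_eq_singleton (i := (0 : Fin (n + 1))) (Or.inl rfl), Finset.sum_singleton, koszulSign_one,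
      map_one, one_smul, TensorProduct.map_tmul, wedge_of_eq_zero 𝓥 (n := (0 : Fin (n + 1))) rfl]
    simp
  · intro i _ hi
    rw [map_sum]
    refine Finset.sum_eq_zero fun σ _ => ?_
    have : (i : ℕ) ≠ 0 := fun h => hi (Fin.ext h)
    rw [map_smul, TensorProduct.map_tmul, hf (n - i) (by omega) _ (wedge_mem_symPow 𝓥 _),
      TensorProduct.tmul_zero, smul_zero]
  · simp

lemma koszulTwist_mul_ι {i : ℤ} {v : V} (hv : v ∈ 𝓥 i) (x : GSym 𝓥) :
    koszulTwist (deg 𝓥) i x * ι 𝓥 v = ι 𝓥 v * x := by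
  induction x using induction_ι_mul 𝓥 with
  | zero => simp
  | one => rw [koszulTwist_one, one_mul, mul_one]
  | add x y hx hy => rw [map_add, add_mul, mul_add, hx, hy]
  | smul c x hx => rw [map_smul, smul_mul_assoc, mul_smul_comm, hx]
  | mul j w hw x hx =>
    rw [koszulTwist_ι_mul 𝓥 i hw, smul_mul_assoc, mul_assoc, hx, ← mul_assoc, ι_mul_ι 𝓥 hw hv,
      units_smul_eq (K := K), smul_mul_assoc, mul_comm j i, signHom_smul_smul_self, mul_assoc]

/-- Each letter may go left or right, and by graded commutativity every one of the `2^n` terms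
multiplies back to the original word. -/
lemma mul_comul_wedge {n : ℕ} {d : Fin n → ℤ} {v : Fin n → V} (hv : ∀ t, v t ∈ 𝓥 (d t)) :
    LinearMap.mul' K (GSym 𝓥) (comul 𝓥 (wedge 𝓥 v)) = (2 ^ n : K) • wedge 𝓥 v := by
  induction n with
  | zero => simp [wedge_zero, comul_one]
  | succ n ih =>
    have key : ∀ w, LinearMap.mul' K (GSym 𝓥) (primitiveMul 𝓥 (d 0) (v 0) w) =
        (2 : K) • (ι 𝓥 (v 0) * LinearMap.mul' K (GSym 𝓥) w) := by
      intro w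
      induction w using TensorProduct.induction_on with
      | zero => simp
      | add w w' h h' => simp only [map_add, h, h', mul_add, smul_add]
      | tmul a b =>
        rw [primitiveMul_tmul, map_add, LinearMap.mul'_apply, LinearMap.mul'_apply,
          LinearMap.mul'_apply, ← mul_assoc _ (ι 𝓥 (v 0)), koszulTwist_mul_ι 𝓥 (hv 0), mul_assoc,
          two_smul]
    rw [wedge_succ, comul_ι_mul 𝓥 (hv 0), key, ih fun t => hv t.succ, mul_smul_comm, smul_smul,
      ← pow_succ']

/-- Multiplication after the coproduct has eigenvalue `2^n` on `SⁿV`, and a primitive element has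
eigenvalue `2`. In characteristic zero `2^n = 2` only for `n = 1`, so independence of eigenspaces
leaves only the part in `V`. -/
lemma eq_ι_of_primitive [CharZero K] {y : GSym 𝓥} (hy : comul 𝓥 y = y ⊗ₜ 1 + 1 ⊗ₜ y) :
    y = ι 𝓥 (proj 𝓥 y) := by
  let M : Module.End K (GSym 𝓥) := LinearMap.mul' K (GSym 𝓥) ∘ₗ comul 𝓥
  have hM : ∀ n, symPow 𝓥 n ≤ M.eigenspace (2 ^ n) := fun n =>
    symPow_le 𝓥 fun d v hv => Module.End.mem_eigenspace_iff.2 (mul_comul_wedge 𝓥 hv)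
  -- `U` contains every `SⁿV` with `n ≠ 1`, so directness of the sum of the `SⁿV` is never needed.
  let U : Submodule K (GSym 𝓥) := ⨆ (μ : K) (_ : μ ≠ 2), M.eigenspace μ
  have htop : LinearMap.range (ι 𝓥) ⊔ U = ⊤ := by
    refine eq_top_of_symPow_le 𝓥 fun n => ?_
    by_cases hn : n = 1
    · subst hn
      refine le_sup_of_le_left ?_
      rw [symPow, Submodule.span_le]
      rintro _ ⟨v, rfl⟩
      exact ⟨v 0, (wedge_one 𝓥 v).symm⟩
    · have h2 : (2 ^ n : K) ≠ 2 := by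
        intro h
        have h' : (2 : ℕ) ^ n = 2 ^ 1 := by exact_mod_cast h
        exact hn (Nat.pow_right_injective le_rfl h')
      exact le_sup_of_le_right ((hM n).trans (le_iSup₂_of_le (2 ^ n : K) h2 le_rfl))
  obtain ⟨_, ⟨u, rfl⟩, w, hw, huw⟩ := Submodule.mem_sup.1 (htop ▸ Submodule.mem_top (x := y))
  have hMy : M y = (2 : K) • y := by
    change LinearMap.mul' K (GSym 𝓥) (comul 𝓥 y) = _
    rw [hy]
    simp [two_smul]
  have hMu : M (ι 𝓥 u) = (2 : K) • ι 𝓥 u := by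
    have := Module.End.mem_eigenspace_iff.1 (hM 1 (wedge_mem_symPow 𝓥 fun _ => u))
    rwa [wedge_one, pow_one] at this
  have hMw : w ∈ M.eigenspace 2 := by
    rw [Module.End.mem_eigenspace_iff, ← add_sub_cancel_left (ι 𝓥 u) w, huw, map_sub, hMy, hMu,
      smul_sub]
  have hw0 : w = 0 := Submodule.disjoint_def.1 (Module.End.eigenspaces_iSupIndep M 2) w hMw hw
  rw [← huw, hw0, add_zero, proj_ι]

/-- Once `E` kills all shorter words, only the extreme terms `x ⊗ 1` and `1 ⊗ x` of `△x` contribute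
to `△(E x)`. So `E x` is primitive, and is recovered from its projection, which is zero. The twist
`β` matters only through its value at `1`. -/
lemma eq_zero_of_coderivation [CharZero K] {E β : GSym 𝓥 →ₗ[K] GSym 𝓥} (hβ : β 1 = 1)
    (hproj : proj 𝓥 ∘ₗ E = 0)
    (hE : comul 𝓥 ∘ₗ E = (TensorProduct.map E β +
      TensorProduct.map (β ∘ₗ koszulTwist (deg 𝓥) p) E) ∘ₗ comul 𝓥) : E = 0 := by
  suffices h : ∀ n, symPow 𝓥 n ≤ LinearMap.ker E from
    LinearMap.ker_eq_top.1 (eq_top_of_symPow_le 𝓥 h)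
  intro n
  induction n using Nat.strong_induction_on with
  | _ n ih =>
    refine symPow_le 𝓥 fun d v hv => ?_
    have h := LinearMap.congr_fun hE (wedge 𝓥 v)
    rw [LinearMap.comp_apply, LinearMap.comp_apply, LinearMap.add_apply,
      map_comul_left 𝓥 (fun k hk x hx => ih k hk hx) hv,
      map_comul_right 𝓥 (fun k hk x hx => ih k hk hx) hv, hβ, LinearMap.comp_apply,
      koszulTwist_one, hβ] at h
    rw [LinearMap.mem_ker, eq_ι_of_primitive 𝓥 h]
    rw [← LinearMap.comp_apply (proj 𝓥), hproj, LinearMap.zero_apply, map_zero]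

section Components

variable (γ : V →ₗ[K] V) (hγ : HasDegree 𝓥 𝓥 0 γ)

lemma twistedLift_wedge {ρ : GSym 𝓥 →ₗ[K] V} {n m : ℕ}
    (hρ : ∀ k, k ≠ n → ∀ x ∈ symPow 𝓥 k, ρ x = 0) (h : n ≤ m)
    {d : Fin m → ℤ} {v : Fin m → V} (hv : ∀ t, v t ∈ 𝓥 (d t)) :
    twistedLift 𝓥 γ hγ ρ (wedge 𝓥 v) = ∑ σ ∈ unshuffles m n, signHom K (koszulSign σ d) •
      (ι 𝓥 (ρ (wedge 𝓥 fun t : Fin n => v (σ ⟨t, by omega⟩))) *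
        wedge 𝓥 fun t : Fin (m - n) => γ (v (σ ⟨n + t, by omega⟩))) := by
  simp only [twistedLift, LinearMap.comp_apply]
  rw [comul_wedge 𝓥 hv, map_sum, map_sum, Finset.sum_eq_single ⟨n, by omega⟩]
  · rw [map_sum, map_sum]
    refine Finset.sum_congr rfl fun σ _ => ?_
    rw [map_smul, map_smul, TensorProduct.map_tmul, LinearMap.mul'_apply, AlgHom.toLinearMap_apply,
      map_wedge, LinearMap.comp_apply]
  · intro i _ hi
    rw [map_sum, map_sum]
    refine Finset.sum_eq_zero fun σ _ => ?_
    rw [map_smul, map_smul, TensorProduct.map_tmul, LinearMap.mul'_apply, LinearMap.comp_apply,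
      hρ i (fun h => hi (Fin.ext h)) _ (wedge_mem_symPow 𝓥 _), map_zero, zero_mul, smul_zero]
  · simp

lemma twistedLift_eq_zero {ρ : GSym 𝓥 →ₗ[K] V} {n m : ℕ}
    (hρ : ∀ k, k ≠ n → ∀ x ∈ symPow 𝓥 k, ρ x = 0) (h : m < n) {x : GSym 𝓥}
    (hx : x ∈ symPow 𝓥 m) : twistedLift 𝓥 γ hγ ρ x = 0 := by
  suffices symPow 𝓥 m ≤ LinearMap.ker (twistedLift 𝓥 γ hγ ρ) from this hx
  refine symPow_le 𝓥 fun d v hv => ?_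
  rw [LinearMap.mem_ker]
  simp only [twistedLift, LinearMap.comp_apply]
  rw [comul_wedge 𝓥 hv, map_sum, map_sum]
  refine Finset.sum_eq_zero fun i _ => ?_
  rw [map_sum, map_sum]
  refine Finset.sum_eq_zero fun σ _ => ?_
  rw [map_smul, map_smul, TensorProduct.map_tmul, LinearMap.mul'_apply, LinearMap.comp_apply,
    hρ i (by omega) _ (wedge_mem_symPow 𝓥 _), map_zero, zero_mul, smul_zero]

lemma twistedLift_mem_symPow {ρ : GSym 𝓥 →ₗ[K] V} {n m k : ℕ}
    (hρ : ∀ k, k ≠ n → ∀ x ∈ symPow 𝓥 k, ρ x = 0) (h : m + 1 = n + k) {x : GSym 𝓥}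
    (hx : x ∈ symPow 𝓥 m) : twistedLift 𝓥 γ hγ ρ x ∈ symPow 𝓥 k := by
  rcases lt_or_ge m n with hmn | hmn
  · rw [twistedLift_eq_zero 𝓥 γ hγ hρ hmn hx]
    exact zero_mem _
  suffices symPow 𝓥 m ≤ (symPow 𝓥 k).comap (twistedLift 𝓥 γ hγ ρ) from this hx
  refine symPow_le 𝓥 fun d v hv => ?_
  rw [Submodule.mem_comap, twistedLift_wedge 𝓥 γ hγ hρ hmn hv]
  refine Submodule.sum_mem _ fun σ _ => Submodule.smul_mem _ _ ?_
  obtain rfl : k = m - n + 1 := by omega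
  have := wedge_mem_symPow 𝓥 (Fin.cons (ρ (wedge 𝓥 fun t : Fin n => v (σ ⟨t, by omega⟩)))
    fun t : Fin (m - n) => γ (v (σ ⟨n + t, by omega⟩)))
  rwa [wedge_succ] at this

end Components

end GSym

/-! ### Descent of graded symmetric multilinear maps from the tensor algebra to `SV`. -/

lemma koszulSign_swap {n : ℕ} {p q : Fin n} (h : (q : ℕ) = p + 1) (d : Fin n → ℤ) :
    koszulSign (Equiv.swap p q) d = Int.negOnePow (d p * d q) := by
  have hpq : p ≠ q := fun e => by rw [e] at h; omega
  have key : ∀ a b : Fin n, a < b → Equiv.swap p q b < Equiv.swap p q a → a = p ∧ b = q := by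
    intro a b hab hs
    rw [Equiv.swap_apply_def, Equiv.swap_apply_def] at hs
    simp only [Fin.ext_iff, Fin.lt_def] at *
    split_ifs at hs <;> omega
  rw [koszulSign, Finset.prod_eq_single p, Finset.prod_eq_single q]
  · rw [if_pos, Equiv.swap_apply_left, Equiv.swap_apply_right, mul_comm]
    rw [Equiv.swap_apply_left, Equiv.swap_apply_right, Fin.lt_def]
    omega
  · intro b _ hb
    exact if_neg fun hh => hb (key _ _ hh.1 hh.2).2
  · simp
  · intro a _ ha
    exact Finset.prod_eq_one fun b _ => if_neg fun hh => ha (key _ _ hh.1 hh.2).1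
  · simp

section TensorAlgebra

variable {K V W : Type*} [Field K] [AddCommGroup V] [Module K V] [AddCommGroup W] [Module K W]
  (𝓥 : ℤ → Submodule K V) [DirectSum.Decomposition 𝓥]

lemma tensorAlgebra_linearMap_ext {f g : TensorAlgebra K V →ₗ[K] W}
    (h : ∀ (n : ℕ) (d : Fin n → ℤ) (v : Fin n → V), (∀ t, v t ∈ 𝓥 (d t)) →
      f (TensorAlgebra.tprod K V n v) = g (TensorAlgebra.tprod K V n v)) : f = g := by
  have key : f ∘ₗ TensorAlgebra.ofDirectSum.toLinearMap =
      g ∘ₗ TensorAlgebra.ofDirectSum.toLinearMap := by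
    refine DirectSum.linearMap_ext K fun n => PiTensorProduct.ext ?_
    refine multilinear_ext_homogeneous 𝓥 fun d v hv => ?_
    simp only [LinearMap.compMultilinearMap_apply, LinearMap.comp_apply,
      AlgHom.toLinearMap_apply, DirectSum.lof_eq_of, TensorAlgebra.ofDirectSum_of_tprod]
    exact h n d v hv
  ext x
  have := LinearMap.congr_fun key (TensorAlgebra.toDirectSum x)
  simpa using this

/-- The linear map on the tensor algebra given by a multilinear map on words of length `k` and by
zero on words of any other length. -/
def tensorAlgebraLift {k : ℕ} (f : MultilinearMap K (fun _ : Fin k => V) W) :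
    TensorAlgebra K V →ₗ[K] W :=
  PiTensorProduct.lift f ∘ₗ DirectSum.component K ℕ (fun n => ⨂[K]^n V) k ∘ₗ
    TensorAlgebra.toDirectSum.toLinearMap

lemma tensorAlgebraLift_tprod {k : ℕ} (f : MultilinearMap K (fun _ : Fin k => V) W)
    (v : Fin k → V) : tensorAlgebraLift f (TensorAlgebra.tprod K V k v) = f v := by
  simp only [tensorAlgebraLift, LinearMap.comp_apply, AlgHom.toLinearMap_apply,
    TensorAlgebra.toDirectSum_tensorPower_tprod]
  rw [← DirectSum.lof_eq_of K, DirectSum.component.lof_self, PiTensorProduct.lift.tprod]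

lemma tensorAlgebraLift_tprod_of_ne {k n : ℕ} (f : MultilinearMap K (fun _ : Fin k => V) W)
    (h : n ≠ k) (v : Fin n → V) : tensorAlgebraLift f (TensorAlgebra.tprod K V n v) = 0 := by
  simp only [tensorAlgebraLift, LinearMap.comp_apply, AlgHom.toLinearMap_apply,
    TensorAlgebra.toDirectSum_tensorPower_tprod]
  rw [← DirectSum.lof_eq_of K, DirectSum.component.of, dif_neg h, map_zero]

lemma tprod_mul_tprod_mul {n m : ℕ} (u : Fin n → V) (w : Fin m → V) (x y : V) :
    TensorAlgebra.tprod K V n u * (TensorAlgebra.ι K x * TensorAlgebra.ι K y) *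
      TensorAlgebra.tprod K V m w =
        TensorAlgebra.tprod K V (n + (m + 2)) (Fin.append u (Fin.cons x (Fin.cons y w))) := by
  simp only [TensorAlgebra.tprod_apply]
  rw [List.ofFn_add, List.prod_append]
  simp [List.ofFn_succ, mul_assoc]

lemma append_cons_cons_swap {n m : ℕ} {X : Type*} (u : Fin n → X) (w : Fin m → X) (x y : X)
    (t : Fin (n + (m + 2))) :
    Fin.append u (Fin.cons x (Fin.cons y w) : Fin (m + 2) → X)
      (Equiv.swap (Fin.natAdd n 0) (Fin.natAdd n 1) t) =
        Fin.append u (Fin.cons y (Fin.cons x w) : Fin (m + 2) → X) t := by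
  induction t using Fin.addCases with
  | left t =>
    rw [Equiv.swap_apply_of_ne_of_ne] <;> simp [Fin.ext_iff] <;> omega
  | right t =>
    induction t using Fin.cases with
    | zero => rw [Equiv.swap_apply_left, Fin.append_right, Fin.append_right]; rfl
    | succ t =>
      induction t using Fin.cases with
      | zero =>
        change Fin.append _ _ (Equiv.swap _ _ (Fin.natAdd n 1)) = _
        rw [Equiv.swap_apply_right, Fin.append_right, Fin.append_right]; rfl
      | succ t =>
        rw [Equiv.swap_apply_of_ne_of_ne, Fin.append_right, Fin.append_right]
        · rfl
        · simp [Fin.ext_iff]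
        · simp [Fin.ext_iff]

end TensorAlgebra

namespace GSym

variable {K V W : Type*} [Field K] [AddCommGroup V] [Module K V] [AddCommGroup W] [Module K W]
  (𝓥 : ℤ → Submodule K V) [DirectSum.Decomposition 𝓥]

omit [DirectSum.Decomposition 𝓥] in
lemma mk_tprod {n : ℕ} (v : Fin n → V) : mk 𝓥 (TensorAlgebra.tprod K V n v) = wedge 𝓥 v := by
  rw [TensorAlgebra.tprod_apply, map_list_prod, List.map_ofFn]
  rfl

/-- Between two words, a generator of the ideal is a difference of words that differ by an adjacent
transposition, with exactly the Koszul sign of that transposition. Symmetry of `f` makes it vanish.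
-/
lemma tensorAlgebraLift_eq_zero {k : ℕ} {f : MultilinearMap K (fun _ : Fin k => V) W}
    (hf : ∀ (d : Fin k → ℤ) (v : Fin k → V), (∀ t, v t ∈ 𝓥 (d t)) → ∀ σ : Equiv.Perm (Fin k),
      f v = signHom K (koszulSign σ d) • f (fun t => v (σ t)))
    {z : TensorAlgebra K V} (hz : z ∈ symIdeal 𝓥) : tensorAlgebraLift f z = 0 := by
  let F := tensorAlgebraLift f
  have hgen : ∀ (i j : ℤ) (x y : V), x ∈ 𝓥 i → y ∈ 𝓥 j → ∀ a b,
      F (a * (TensorAlgebra.ι K x * TensorAlgebra.ι K y -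
        Int.negOnePow (i * j) • (TensorAlgebra.ι K y * TensorAlgebra.ι K x)) * b) = 0 := by
    intro i j x y hx hy a b
    set z := TensorAlgebra.ι K x * TensorAlgebra.ι K y -
        Int.negOnePow (i * j) • (TensorAlgebra.ι K y * TensorAlgebra.ι K x) with hzdef
    suffices h : F ∘ₗ LinearMap.mulRight K (z * b) = 0 by
      have := LinearMap.congr_fun h a
      rwa [LinearMap.comp_apply, LinearMap.mulRight_apply, ← mul_assoc] at this
    refine tensorAlgebra_linearMap_ext 𝓥 fun n d u hu => ?_
    rw [LinearMap.comp_apply, LinearMap.mulRight_apply, ← mul_assoc, LinearMap.zero_apply]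
    suffices h : F ∘ₗ LinearMap.mulLeft K (TensorAlgebra.tprod K V n u * z) = 0 from
      LinearMap.congr_fun h b
    refine tensorAlgebra_linearMap_ext 𝓥 fun m e w hw => ?_
    rw [LinearMap.comp_apply, LinearMap.mulLeft_apply, LinearMap.zero_apply, hzdef,
      units_smul_eq (K := K), mul_sub, sub_mul, mul_smul_comm, smul_mul_assoc, map_sub, map_smul,
      tprod_mul_tprod_mul, tprod_mul_tprod_mul]
    rcases eq_or_ne (n + (m + 2)) k with hk | hk
    · subst hk
      simp only [F, tensorAlgebraLift_tprod]
      have h0 : ∀ t, Fin.append u (Fin.cons x (Fin.cons y w) : Fin (m + 2) → V) t ∈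
          𝓥 (Fin.append d (Fin.cons i (Fin.cons j e) : Fin (m + 2) → ℤ) t) := by
        intro t
        induction t using Fin.addCases with
        | left t => simpa using hu t
        | right t =>
          rw [Fin.append_right, Fin.append_right]
          induction t using Fin.cases with
          | zero => exact hx
          | succ t =>
            induction t using Fin.cases with
            | zero => exact hy
            | succ t => exact hw t
      have h1 := hf _ _ h0 (Equiv.swap (Fin.natAdd n 0) (Fin.natAdd n 1))
      simp only [append_cons_cons_swap] at h1
      rw [koszulSign_swap (by simp), Fin.append_right, Fin.append_right] at h1
      rw [h1, sub_eq_zero]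
      rfl
    · simp only [F, tensorAlgebraLift_tprod_of_ne f hk, smul_zero, sub_zero]
  -- The kernel of a linear map is not an ideal. `J` is a two-sided ideal contained in it (take `a =
  -- b = 1`), and it contains the generators.
  let J : TwoSidedIdeal (TensorAlgebra K V) := TwoSidedIdeal.mk' {z | ∀ a b, F (a * z * b) = 0}
    (fun a b => by simp) (fun {x y} hx hy a b => by rw [mul_add, add_mul, map_add, hx, hy, add_zero])
    (fun {x} hx a b => by rw [mul_neg, neg_mul, map_neg, hx, neg_zero])
    (fun {x y} hy a b => by rw [← mul_assoc]; exact hy _ _)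
    (fun {x y} hx a b => by rw [← mul_assoc, mul_assoc]; exact hx _ _)
  have hJ : symIdeal 𝓥 ≤ J := by
    rw [symIdeal, TwoSidedIdeal.span_le]
    rintro _ ⟨i, j, x, y, hx, hy, rfl⟩
    rw [SetLike.mem_coe, TwoSidedIdeal.mem_mk']
    exact hgen i j x y hx hy
  have := hJ hz
  rw [TwoSidedIdeal.mem_mk'] at this
  simpa using this 1 1

/-- Graded symmetric multilinear maps descend to `SᵏV`. -/
lemma exists_linearMap_of_symmetric {k : ℕ} (f : MultilinearMap K (fun _ : Fin k => V) W)
    (hf : ∀ (d : Fin k → ℤ) (v : Fin k → V), (∀ t, v t ∈ 𝓥 (d t)) → ∀ σ : Equiv.Perm (Fin k),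
      f v = signHom K (koszulSign σ d) • f (fun t => v (σ t))) :
    ∃ ρ : GSym 𝓥 →ₗ[K] W, (∀ v, ρ (wedge 𝓥 v) = f v) ∧
      ∀ n, n ≠ k → ∀ x ∈ symPow 𝓥 n, ρ x = 0 := by
  let ρ : GSym 𝓥 →ₗ[K] W := Submodule.liftQ ((symIdeal 𝓥).asIdeal.restrictScalars K)
    (tensorAlgebraLift f) fun z hz => tensorAlgebraLift_eq_zero 𝓥 hf (TwoSidedIdeal.mem_asIdeal.1 hz)
  have hρ : ∀ z, ρ (mk 𝓥 z) = tensorAlgebraLift f z := fun z => rfl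
  refine ⟨ρ, fun v => ?_, fun n hn => ?_⟩
  · rw [← mk_tprod, hρ, tensorAlgebraLift_tprod]
  · suffices symPow 𝓥 n ≤ LinearMap.ker ρ from this
    refine symPow_le 𝓥 fun d v _ => ?_
    rw [LinearMap.mem_ker, ← mk_tprod, hρ, tensorAlgebraLift_tprod_of_ne f hn]

end GSym

/-! ### Sums of twisted lifts and their squares. -/

section

open GSym

variable {K V : Type*} [Field K] [AddCommGroup V] [Module K V]
  {𝓥 : ℤ → Submodule K V} [DirectSum.Decomposition 𝓥] {α : V →ₗ[K] V} (hα : HasDegree 𝓥 𝓥 0 α)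
  {p : ℤ}

section TensorMap

variable {M N P Q : Type*} [AddCommGroup M] [AddCommGroup N] [AddCommGroup P] [AddCommGroup Q]
  [Module K M] [Module K N] [Module K P] [Module K Q]

lemma tensorMap_sub_left (f f' : M →ₗ[K] P) (g : N →ₗ[K] Q) :
    TensorProduct.map (f - f') g = TensorProduct.map f g - TensorProduct.map f' g :=
  TensorProduct.ext' fun x y => by simp [TensorProduct.sub_tmul]

lemma tensorMap_sub_right (f : M →ₗ[K] P) (g g' : N →ₗ[K] Q) :
    TensorProduct.map f (g - g') = TensorProduct.map f g - TensorProduct.map f g' :=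
  TensorProduct.ext' fun x y => by simp [TensorProduct.tmul_sub]

lemma tensorMap_sum_left {ι : Type*} (s : Finset ι) (f : ι → M →ₗ[K] P) (g : N →ₗ[K] Q) :
    TensorProduct.map (∑ i ∈ s, f i) g = ∑ i ∈ s, TensorProduct.map (f i) g :=
  TensorProduct.ext' fun x y => by simp [TensorProduct.sum_tmul]

lemma tensorMap_sum_right {ι : Type*} (s : Finset ι) (f : M →ₗ[K] P) (g : ι → N →ₗ[K] Q) :
    TensorProduct.map f (∑ i ∈ s, g i) = ∑ i ∈ s, TensorProduct.map f (g i) :=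
  TensorProduct.ext' fun x y => by simp [TensorProduct.tmul_sum]

end TensorMap

section Lift

variable {n : ℕ} {ρ : GSym 𝓥 →ₗ[K] V}

lemma IsComponent.comm_apply (h : IsComponent 𝓥 α p n ρ) (x : GSym 𝓥) :
    α (ρ x) = ρ (GSym.map 𝓥 α hα x) := by
  suffices α ∘ₗ ρ = ρ ∘ₗ (GSym.map 𝓥 α hα).toLinearMap from LinearMap.congr_fun this x
  refine linearMap_ext_wedge 𝓥 fun m d v _ => ?_
  rw [LinearMap.comp_apply, LinearMap.comp_apply, AlgHom.toLinearMap_apply, map_wedge]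
  by_cases hm : m = n
  · subst hm
    exact h.comm v
  · rw [h.supported m hm _ (wedge_mem_symPow 𝓥 v), h.supported m hm _ (wedge_mem_symPow 𝓥 _),
      map_zero]

lemma IsComponent.comm_pow_apply (h : IsComponent 𝓥 α p n ρ) (m : ℕ) (x : GSym 𝓥) :
    (α ^ m) (ρ x) = ρ (GSym.map 𝓥 (α ^ m) (hα.pow m) x) := by
  rw [← GSym.map_pow 𝓥 α hα]
  induction m generalizing x with
  | zero => rfl
  | succ m ih => rw [pow_succ, Module.End.mul_apply, h.comm_apply hα, ih, pow_succ, AlgHom.mul_apply]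

lemma isTwistedLift_twistedLift (h : IsComponent 𝓥 α p n ρ) :
    IsTwistedLift 𝓥 α hα p n ρ (twistedLift 𝓥 (α ^ (n - 1)) (hα.pow _) ρ) where
  degree := twistedLift_hasDegree 𝓥 _ _ h.degree
  lifts := LinearMap.ext fun x => proj_twistedLift 𝓥 _ _ h.degree x
  comm := LinearMap.ext fun x =>
    map_twistedLift 𝓥 _ _ hα (Commute.self_pow α _) (h.comm_apply hα) x
  coder := LinearMap.ext fun x => by
    rw [GSym.map_pow]
    exact comul_twistedLift 𝓥 _ _ h.degree x

/-- The difference of two lifts is a twisted coderivation with zero projection, so rigidity applies.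
-/
lemma isTwistedLift_iff [CharZero K] (h : IsComponent 𝓥 α p n ρ) {R : GSym 𝓥 →ₗ[K] GSym 𝓥} :
    IsTwistedLift 𝓥 α hα p n ρ R ↔ R = twistedLift 𝓥 (α ^ (n - 1)) (hα.pow _) ρ := by
  refine ⟨fun hR => ?_, fun hR => hR ▸ isTwistedLift_twistedLift hα h⟩
  have hS := isTwistedLift_twistedLift hα h
  rw [← sub_eq_zero]
  refine eq_zero_of_coderivation 𝓥 (β := (GSym.map 𝓥 α hα ^ (n - 1)).toLinearMap) (p := p)
    (by simp) (by rw [LinearMap.comp_sub, hR.lifts, hS.lifts, sub_self]) ?_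
  rw [LinearMap.comp_sub, hR.coder, hS.coder, ← LinearMap.sub_comp, tensorMap_sub_left,
    tensorMap_sub_right]
  congr 1
  abel

end Lift

variable (ρ : ℕ → GSym 𝓥 →ₗ[K] V)

/-- The twisted lift of the `n`-th component of a family `ρ`. -/
def componentLift (n : ℕ) : GSym 𝓥 →ₗ[K] GSym 𝓥 :=
  twistedLift 𝓥 (α ^ (n - 1)) (hα.pow _) (ρ n)

variable {ρ} (hρ : ∀ n, 1 ≤ n → IsComponent 𝓥 α p n (ρ n))

include hρ in
lemma componentLift_eq_zero {n m : ℕ} (h : m < n) {x : GSym 𝓥} (hx : x ∈ symPow 𝓥 m) :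
    componentLift hα ρ n x = 0 :=
  twistedLift_eq_zero 𝓥 _ _ (hρ n (by omega)).supported h hx

include hρ in
lemma componentLift_mem_symPow {n m k : ℕ} (hn : 1 ≤ n) (h : m + 1 = n + k) {x : GSym 𝓥}
    (hx : x ∈ symPow 𝓥 m) : componentLift hα ρ n x ∈ symPow 𝓥 k :=
  twistedLift_mem_symPow 𝓥 _ _ (hρ n hn).supported h hx

-- Local finiteness: the lift of an `n`-ary component kills words shorter than `n`, and every
-- element is a finite sum of words.
include hρ in
lemma exists_componentLift_eq_zero (x : GSym 𝓥) :
    ∃ N, ∀ n, N < n → componentLift hα ρ n x = 0 := by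
  let P : Submodule K (GSym 𝓥) :=
    { carrier := {x | ∃ N, ∀ n, N < n → componentLift hα ρ n x = 0}
      zero_mem' := ⟨0, fun n _ => map_zero _⟩
      add_mem' := by
        rintro x y ⟨N, hN⟩ ⟨M, hM⟩
        refine ⟨max N M, fun n hn => ?_⟩
        rw [map_add, hN n (by omega), hM n (by omega), add_zero]
      smul_mem' := by
        rintro c x ⟨N, hN⟩
        exact ⟨N, fun n hn => by rw [map_smul, hN n hn, smul_zero]⟩ }
  have : P = ⊤ := eq_top_of_symPow_le 𝓥 fun n x hx =>
    ⟨n, fun m hm => componentLift_eq_zero hα hρ hm hx⟩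
  exact (this ▸ Submodule.mem_top : x ∈ P)

lemma finsum_one_le_eq_sum_range {M : Type*} [AddCommMonoid M] {f : ℕ → M} {N : ℕ}
    (h : ∀ n, N < n → f n = 0) :
    ∑ᶠ (n : ℕ) (_ : 1 ≤ n), f n = ∑ a ∈ Finset.range N, f (a + 1) := by
  rw [finsum_eq_sum_of_support_subset (s := Finset.Ico 1 (N + 1)), Finset.sum_Ico_eq_sum_range]
  · refine Finset.sum_congr (by simp) fun a _ => ?_
    rw [add_comm 1 a]
    exact finsum_eq_if.trans (if_pos (by omega))
  · intro n hn
    rw [Function.mem_support] at hn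
    by_contra hcon
    refine hn ?_
    rw [finsum_eq_if]
    split_ifs with h1
    · refine h n ?_
      simp only [Finset.coe_Ico, Set.mem_Ico] at hcon
      omega
    · rfl

lemma isSumOfLifts_iff [CharZero K] {D : GSym 𝓥 →ₗ[K] GSym 𝓥} : IsSumOfLifts 𝓥 α hα p ρ D ↔
    (∀ n, 1 ≤ n → IsComponent 𝓥 α p n (ρ n)) ∧
      ∀ x, D x = ∑ᶠ (n : ℕ) (_ : 1 ≤ n), componentLift hα ρ n x := by
  refine and_congr_right fun hρ => ⟨?_, fun hD => ?_⟩
  · rintro ⟨R, hR, hD⟩ x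
    rw [(hD x).2]
    refine finsum_congr fun n => finsum_congr fun hn => ?_
    rw [(isTwistedLift_iff hα (hρ n hn)).1 (hR n hn)]
    rfl
  · refine ⟨componentLift hα ρ, fun n hn => isTwistedLift_twistedLift hα (hρ n hn),
      fun x => ⟨?_, hD x⟩⟩
    obtain ⟨N, hN⟩ := exists_componentLift_eq_zero hα hρ x
    refine (Set.finite_Iic N).subset fun n hn => ?_
    by_contra hcon
    exact hn.2 (hN n (by simpa using hcon))

include hρ in
lemma exists_isSumOfLifts [CharZero K] : ∃ D, IsSumOfLifts 𝓥 α hα p ρ D := by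
  choose N hN using exists_componentLift_eq_zero hα hρ
  refine ⟨{ toFun := fun x => ∑ᶠ (n : ℕ) (_ : 1 ≤ n), componentLift hα ρ n x
            map_add' := fun x y => ?_
            map_smul' := fun c x => ?_ }, (isSumOfLifts_iff hα).2 ⟨hρ, fun x => rfl⟩⟩
  · rw [finsum_one_le_eq_sum_range (N := max (N x) (N y)) fun n hn => ?_,
      finsum_one_le_eq_sum_range (N := max (N x) (N y)) fun n hn => hN x n (by omega),
      finsum_one_le_eq_sum_range (N := max (N x) (N y)) fun n hn => hN y n (by omega),
      ← Finset.sum_add_distrib]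
    · exact Finset.sum_congr rfl fun a _ => map_add _ _ _
    · rw [map_add, hN x n (by omega), hN y n (by omega), add_zero]
  · rw [finsum_one_le_eq_sum_range (N := N x) fun n hn => ?_,
      finsum_one_le_eq_sum_range (N := N x) fun n hn => hN x n hn, Finset.smul_sum]
    · exact Finset.sum_congr rfl fun a _ => map_smul _ _ _
    · rw [map_smul, hN x n hn, smul_zero]

/-- The bound `N` is left free so that the infinite sum can be truncated at any convenient length.
-/
lemma IsSumOfLifts.apply_of_mem_symPow [CharZero K] {D : GSym 𝓥 →ₗ[K] GSym 𝓥}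
    (hD : IsSumOfLifts 𝓥 α hα p ρ D) {m N : ℕ} (h : m ≤ N) {x : GSym 𝓥} (hx : x ∈ symPow 𝓥 m) :
    D x = ∑ a ∈ Finset.range N, componentLift hα ρ (a + 1) x := by
  rw [((isSumOfLifts_iff hα).1 hD).2 x, finsum_one_le_eq_sum_range fun n hn =>
    componentLift_eq_zero hα hD.1 (h.trans_lt hn) hx]

/-- `D` determines its components; this is what gives injectivity of the correspondence. -/
lemma IsSumOfLifts.proj_apply [CharZero K] {D : GSym 𝓥 →ₗ[K] GSym 𝓥}
    (hD : IsSumOfLifts 𝓥 α hα p ρ D) {m : ℕ} (hm : 1 ≤ m) {x : GSym 𝓥} (hx : x ∈ symPow 𝓥 m) :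
    proj 𝓥 (D x) = ρ m x := by
  have h : ∀ a, proj 𝓥 (componentLift hα ρ (a + 1) x) = ρ (a + 1) x := fun a =>
    proj_twistedLift 𝓥 _ _ (hD.1 (a + 1) (by omega)).degree x
  rw [hD.apply_of_mem_symPow hα le_rfl hx, map_sum]
  simp only [h]
  rw [Finset.sum_eq_single (m - 1)]
  · rw [Nat.sub_add_cancel hm]
  · intro a _ ha
    exact (hD.1 (a + 1) (by omega)).supported m (by omega) x hx
  · intro h
    exact absurd (Finset.mem_range.2 (by omega)) h

/-- The part `∑_{i + j = n + 1} ρ̃ⱼ ∘ ρ̃ᵢ` of the square of `∑ ρ̃ₙ`. -/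
def squarePart (ρ : ℕ → GSym 𝓥 →ₗ[K] V) (n : ℕ) : GSym 𝓥 →ₗ[K] GSym 𝓥 :=
  ∑ r : Fin n, componentLift hα ρ (n - r) ∘ₗ componentLift hα ρ ((r : ℕ) + 1)

lemma IsSumOfLifts.apply_apply [CharZero K] {D : GSym 𝓥 →ₗ[K] GSym 𝓥}
    (hD : IsSumOfLifts 𝓥 α hα p ρ D) {m : ℕ} {x : GSym 𝓥} (hx : x ∈ symPow 𝓥 m) :
    D (D x) = ∑ n ∈ Finset.range m, squarePart hα ρ (n + 1) x := by
  let F : ℕ → ℕ → GSym 𝓥 := fun a b => componentLift hα ρ (b + 1) (componentLift hα ρ (a + 1) x)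
  have hmem : ∀ a < m, componentLift hα ρ (a + 1) x ∈ symPow 𝓥 (m - a) := fun a ha =>
    componentLift_mem_symPow hα hD.1 (by omega) (by omega) hx
  have h1 : D (D x) = ∑ a ∈ Finset.range m, ∑ b ∈ Finset.range (m - a), F a b := by
    rw [hD.apply_of_mem_symPow hα le_rfl hx, map_sum]
    refine Finset.sum_congr rfl fun a ha => ?_
    rw [hD.apply_of_mem_symPow hα le_rfl (hmem a (Finset.mem_range.1 ha))]
  -- With arities `a + 1` and `b + 1`, the terms are regrouped along `a + b = n`, that is, by the
  -- total shift of word length.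
  rw [h1, ← Finset.sum_range_diag_flip]
  refine Finset.sum_congr rfl fun n _ => ?_
  rw [squarePart, LinearMap.sum_apply, Finset.sum_range]
  refine Finset.sum_congr rfl fun r _ => ?_
  have : n + 1 - (r : ℕ) = n - r + 1 := by omega
  rw [this]
  rfl

include hρ in
lemma proj_squarePart (n : ℕ) (x : GSym 𝓥) : proj 𝓥 (squarePart hα ρ n x) =
    ∑ r : Fin n, ρ (n - r) (componentLift hα ρ ((r : ℕ) + 1) x) := by
  rw [squarePart, LinearMap.sum_apply, map_sum]
  exact Finset.sum_congr rfl fun r _ =>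
    proj_twistedLift 𝓥 _ _ (hρ (n - r) (by omega)).degree _

include hρ in
lemma proj_squarePart_eq_zero {n m : ℕ} (h : n ≠ m) {x : GSym 𝓥} (hx : x ∈ symPow 𝓥 m) :
    proj 𝓥 (squarePart hα ρ n x) = 0 := by
  rw [proj_squarePart hα hρ]
  refine Finset.sum_eq_zero fun r _ => ?_
  rcases lt_or_ge m ((r : ℕ) + 1) with hr | hr
  · rw [componentLift_eq_zero hα hρ hr hx, map_zero]
  · exact (hρ (n - r) (by omega)).supported (m - r) (by omega) _
      (componentLift_mem_symPow hα hρ (by omega) (by omega) hx)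

-- Composing two coderivation identities yields two diagonal terms and two mixed ones. Moving the
-- sign operator past a lift of odd degree produces a minus sign, so exchanging the arities `i` and
-- `j` turns one mixed term into the negative of the other.
include hρ in
lemma squarePart_coder (hp : Odd p) (n : ℕ) :
    comul 𝓥 ∘ₗ squarePart hα ρ n =
      (TensorProduct.map (squarePart hα ρ n) (GSym.map 𝓥 (α ^ (n - 1)) (hα.pow _)).toLinearMap +
        TensorProduct.map ((GSym.map 𝓥 (α ^ (n - 1)) (hα.pow _)).toLinearMap ∘ₗ
          koszulTwist (deg 𝓥) (p + p)) (squarePart hα ρ n)) ∘ₗ comul 𝓥 := by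
  have hpp : Int.negOnePow (p * p) = -1 := Int.negOnePow_odd _ (hp.mul hp)
  let T := koszulTwist (deg 𝓥) p
  have hTT : ∀ x, T (T x) = koszulTwist (deg 𝓥) (p + p) x := koszulTwist_koszulTwist (deg 𝓥) p p
  let β : ℕ → GSym 𝓥 →ₗ[K] GSym 𝓥 := fun m => (GSym.map 𝓥 (α ^ m) (hα.pow m)).toLinearMap
  have hβmul : ∀ m k x, β m (β k x) = β (m + k) x := fun m k x => by
    simp only [β, ← GSym.map_pow 𝓥 α hα, AlgHom.toLinearMap_apply, pow_add, AlgHom.mul_apply]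
  have hβT : ∀ m x, T (β m x) = β m (T x) := fun m x => by
    have := (map_hasDegree 𝓥 (α ^ m) (hα.pow m)).koszulTwist_apply (deg 𝓥) (deg 𝓥) p x
    rwa [mul_zero, Int.negOnePow_zero, map_one, one_smul] at this
  have hRβ : ∀ i, 1 ≤ i → ∀ m x, β m (componentLift hα ρ i x) = componentLift hα ρ i (β m x) :=
    fun i hi m x => map_twistedLift 𝓥 _ _ (hα.pow m) (Commute.pow_pow_self α m (i - 1))
      ((hρ i hi).comm_pow_apply hα m) x
  have hRT : ∀ i, 1 ≤ i → ∀ x, T (componentLift hα ρ i x) = -componentLift hα ρ i (T x) := by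
    intro i hi x
    have := (twistedLift_hasDegree 𝓥 (α ^ (i - 1)) (hα.pow _) (hρ i hi).degree).koszulTwist_apply
      (deg 𝓥) (deg 𝓥) p x
    rw [hpp, signHom_neg_one, neg_one_smul] at this
    exact this
  have hR : ∀ i, 1 ≤ i → ∀ x, comul 𝓥 (componentLift hα ρ i x) =
      TensorProduct.map (componentLift hα ρ i) (β (i - 1)) (comul 𝓥 x) +
        TensorProduct.map (β (i - 1) ∘ₗ T) (componentLift hα ρ i) (comul 𝓥 x) := fun i hi x =>
    comul_twistedLift 𝓥 _ _ (hρ i hi).degree x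
  -- `A r` is the mixed term for `i = r + 1`, `j = n - r`. `Fin.rev` exchanges `i` and `j`, so the
  -- differences `A r - A (Fin.rev r)` sum to zero.
  let A : Fin n → GSym 𝓥 ⊗[K] GSym 𝓥 →ₗ[K] GSym 𝓥 ⊗[K] GSym 𝓥 := fun r =>
    TensorProduct.map (componentLift hα ρ (n - r) ∘ₗ β r ∘ₗ T)
      (componentLift hα ρ ((r : ℕ) + 1) ∘ₗ β (n - r - 1))
  have hcomp : ∀ (r : Fin n) (x : GSym 𝓥),
      comul 𝓥 (componentLift hα ρ (n - r) (componentLift hα ρ ((r : ℕ) + 1) x)) =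
        (TensorProduct.map (componentLift hα ρ (n - r) ∘ₗ componentLift hα ρ ((r : ℕ) + 1))
            (β (n - 1)) +
          TensorProduct.map (β (n - 1) ∘ₗ koszulTwist (deg 𝓥) (p + p))
            (componentLift hα ρ (n - r) ∘ₗ componentLift hα ρ ((r : ℕ) + 1)) +
          A r - A (Fin.rev r)) (comul 𝓥 x) := by
    intro r x
    rw [hR _ (by omega), hR _ (by omega)]
    generalize comul 𝓥 x = w
    induction w using TensorProduct.induction_on with
    | zero => simp
    | add w w' h h' =>
      refine Eq.trans ?_ ((congrArg₂ (· + ·) h h').trans ?_) <;>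
        simp only [map_add] <;> abel
    | tmul a b =>
      have e1 : n - (r : ℕ) - 1 + ((r : ℕ) + 1 - 1) = n - 1 := by omega
      have e2 : n - (n - ((r : ℕ) + 1)) = r + 1 := by omega
      have e3 : n - ((r : ℕ) + 1) = n - r - 1 := by omega
      have e4 : n - (r : ℕ) - 1 + 1 = n - r := by omega
      have e5 : (r : ℕ) + 1 - 1 = r := by omega
      simp only [A, LinearMap.add_apply, LinearMap.sub_apply, map_add, TensorProduct.map_tmul,
        LinearMap.comp_apply, Fin.val_rev, e2]
      simp only [e3, e4, e5, hβmul, hβT, hRT _ (Nat.le_add_left 1 r), map_neg, hTT,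
        TensorProduct.neg_tmul, hRβ _ (Nat.le_add_left 1 r)]
      rw [show n - (r : ℕ) - 1 + r = n - 1 by omega]
      abel
  ext x
  simp only [LinearMap.comp_apply]
  rw [squarePart, LinearMap.sum_apply, map_sum]
  simp only [LinearMap.comp_apply, hcomp]
  rw [← LinearMap.sum_apply, Finset.sum_sub_distrib, Finset.sum_add_distrib,
    Finset.sum_add_distrib, Equiv.sum_comp Fin.revPerm A |>.symm]
  simp only [Fin.revPerm_apply, add_sub_cancel_right]
  rw [tensorMap_sum_left, tensorMap_sum_right]

/-- After projection to `V`, words of length `n` see only `squarePart n`, which isolates the `n`-th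
condition. Conversely, these conditions say that each `squarePart n` has zero projection, so each
vanishes by rigidity. -/
lemma IsSumOfLifts.comp_self_eq_zero_iff [CharZero K] (hp : Odd p) {D : GSym 𝓥 →ₗ[K] GSym 𝓥}
    (hD : IsSumOfLifts 𝓥 α hα p ρ D) : D ∘ₗ D = 0 ↔
      ∀ n, 1 ≤ n → ∀ (d : Fin n → ℤ) (v : Fin n → V), (∀ t, v t ∈ 𝓥 (d t)) →
        ∑ r : Fin n, ρ (n - r) (componentLift hα ρ ((r : ℕ) + 1) (wedge 𝓥 v)) = 0 := by
  constructor
  · intro h n hn d v hv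
    have h1 := hD.apply_apply hα (wedge_mem_symPow 𝓥 v)
    rw [← LinearMap.comp_apply, h, LinearMap.zero_apply] at h1
    have h2 := congrArg (proj 𝓥) h1
    rw [map_zero, map_sum, Finset.sum_eq_single (n - 1), Nat.sub_add_cancel hn,
      proj_squarePart hα hD.1] at h2
    · exact h2.symm
    · intro m _ hm
      exact proj_squarePart_eq_zero hα hD.1 (by omega) (wedge_mem_symPow 𝓥 v)
    · intro h
      exact absurd (Finset.mem_range.2 (by omega)) h
  · intro h
    have hz : ∀ n, 1 ≤ n → squarePart hα ρ n = 0 := by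
      intro n hn
      refine eq_zero_of_coderivation 𝓥 (by simp) ?_ (squarePart_coder hα hD.1 hp n)
      refine linearMap_ext_wedge 𝓥 fun m d v hv => ?_
      rw [LinearMap.comp_apply, LinearMap.zero_apply]
      rcases eq_or_ne n m with rfl | hnm
      · rw [proj_squarePart hα hD.1]
        exact h n hn d v hv
      · exact proj_squarePart_eq_zero hα hD.1 hnm (wedge_mem_symPow 𝓥 v)
    refine linearMap_ext_wedge 𝓥 fun m d v _ => ?_
    rw [LinearMap.comp_apply, hD.apply_apply hα (wedge_mem_symPow 𝓥 v), LinearMap.zero_apply]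
    refine Finset.sum_eq_zero fun n _ => ?_
    rw [hz (n + 1) (by omega), LinearMap.zero_apply]

end

/-! ### Décalage signs. -/

section

section Signs

lemma negOnePow_sum {ι : Type*} (s : Finset ι) (f : ι → ℤ) :
    Int.negOnePow (∑ i ∈ s, f i) = ∏ i ∈ s, Int.negOnePow (f i) := by
  classical
  induction s using Finset.induction_on with
  | empty => simp
  | insert a s ha ih => rw [Finset.sum_insert ha, Finset.prod_insert ha, Int.negOnePow_add, ih]

lemma negOnePow_natCast_mul (m : ℕ) (d : ℤ) :
    Int.negOnePow (m * d) = Int.negOnePow d ^ m := by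
  induction m with
  | zero => simp
  | succ m ih => rw [Nat.cast_succ, add_mul, one_mul, Int.negOnePow_add, ih, pow_succ]

/-- The sign relating a multilinear map on `L` and the corresponding one on `sL`. -/
def decalageSign {k : ℕ} (d : Fin k → ℤ) : ℤˣ :=
  Int.negOnePow (∑ t : Fin k, ((k : ℤ) - 1 - (t : ℕ)) * d t)

lemma decalageSign_eq_prod {k : ℕ} (d : Fin k → ℤ) :
    decalageSign d = ∏ t : Fin k, Int.negOnePow (d t) ^ (k - 1 - (t : ℕ)) := by
  rw [decalageSign, negOnePow_sum]
  refine Finset.prod_congr rfl fun t _ => ?_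
  rw [← negOnePow_natCast_mul]
  congr 2
  have := t.2
  omega

/-- When `(s^{-1})^{⊗k}` is applied, the `k - 1 - t` later copies of `s^{-1}` pass the `t`-th
argument, of degree `d t + 1`. The prefactor cancels the contribution of the summands `1`, since `∑
(k - 1 - t) = k(k-1)/2`. -/
lemma suspension_sign {k : ℕ} (d : Fin k → ℤ) : (-1 : ℤˣ) ^ (k * (k - 1) / 2) *
    Int.negOnePow (∑ t : Fin k, ((k : ℤ) - 1 - (t : ℕ)) * (d t + 1)) = decalageSign d := by
  have h1 : ∑ t : Fin k, ((k : ℤ) - 1 - (t : ℕ)) = ((k * (k - 1) / 2 : ℕ) : ℤ) := by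
    rw [← Finset.sum_range_id, Nat.cast_sum, ← Finset.sum_range_reflect, Finset.sum_range]
    refine Finset.sum_congr rfl fun t _ => ?_
    have := t.2
    omega
  simp only [mul_add, mul_one, Finset.sum_add_distrib, h1]
  rw [Int.negOnePow_add, decalageSign, mul_left_comm]
  have h2 : (-1 : ℤˣ) ^ (k * (k - 1) / 2) = Int.negOnePow ((k * (k - 1) / 2 : ℕ) : ℤ) := by
    rw [Int.negOnePow_def, zpow_natCast]
  rw [h2, Int.units_mul_self, mul_one]

lemma sign_eq_prod_inversions {n : ℕ} (σ : Equiv.Perm (Fin n)) :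
    Equiv.Perm.sign σ = ∏ p : Fin n, ∏ q : Fin n, if p < q ∧ σ q < σ p then -1 else 1 := by
  rw [Equiv.Perm.sign_eq_prod_prod_Ioi]
  refine Finset.prod_congr rfl fun p _ => ?_
  rw [← Finset.filter_lt_eq_Ioi, Finset.prod_filter]
  refine Finset.prod_congr rfl fun q _ => ?_
  by_cases h : p < q
  · have : σ p ≠ σ q := fun e => h.ne (σ.injective e)
    rcases lt_or_gt_of_ne this with h' | h'
    · rw [if_pos h, if_pos h', if_neg fun hh => lt_asymm h' hh.2]
    · rw [if_pos h, if_neg (lt_asymm h'), if_pos ⟨h, h'⟩]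
  · rw [if_neg h, if_neg fun hh => h hh.1]

/-- The number of inversions involving position `p` is congruent modulo 2 to the number of `q` with
`p < q` plus the number with `σ p < σ q`, because a pair is inverted exactly when these two
comparisons disagree. -/
lemma prod_inversions {n : ℕ} (σ : Equiv.Perm (Fin n)) (x : Fin n → ℤˣ) :
    (∏ p : Fin n, ∏ q : Fin n, if p < q ∧ σ q < σ p then x (σ p) * x (σ q) else 1) =
      (∏ p : Fin n, x (σ p) ^ (n - 1 - (p : ℕ))) * ∏ p : Fin n, x p ^ (n - 1 - (p : ℕ)) := by
  have h1 : ∀ p q : Fin n, (if p < q ∧ σ q < σ p then x (σ p) * x (σ q) else 1) =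
      (if p < q ∧ σ q < σ p then x (σ p) else 1) * if p < q ∧ σ q < σ p then x (σ q) else 1 := by
    intro p q
    split_ifs <;> simp
  have h2 : ∀ p q : Fin n, ((if p < q ∧ σ q < σ p then x (σ p) else 1) *
      if q < p ∧ σ p < σ q then x (σ p) else 1) =
        (if p < q then x (σ p) else 1) * if σ p < σ q then x (σ p) else 1 := by
    intro p q
    rcases lt_trichotomy p q with h | rfl | h
    · have : σ p ≠ σ q := fun e => h.ne (σ.injective e)
      rcases lt_or_gt_of_ne this with h' | h' <;> simp [h, h', lt_asymm h, lt_asymm h']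
    · simp
    · simp [h, lt_asymm h]
  have h3 : ∀ (p : Fin n) (y : ℤˣ), (∏ q : Fin n, if p < q then y else 1) =
      y ^ (n - 1 - (p : ℕ)) := by
    intro p y
    rw [← Finset.prod_filter, Finset.filter_lt_eq_Ioi, Finset.prod_const, Fin.card_Ioi]
  simp_rw [h1, Finset.prod_mul_distrib]
  rw [Finset.prod_comm (f := fun p q => if p < q ∧ σ q < σ p then x (σ q) else 1)]
  simp_rw [← Finset.prod_mul_distrib, h2, Finset.prod_mul_distrib, h3]
  congr 1
  rw [← Equiv.prod_comp σ fun p => x p ^ (n - 1 - (p : ℕ))]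
  refine Finset.prod_congr rfl fun p _ => ?_
  rw [Equiv.prod_comp σ fun q => if σ p < q then x (σ p) else 1, h3]

/-- For each inversion `(a + 1)(b + 1) = ab + 1 + (a + b)`: the first term gives `ε(σ)`, the second
`sgn(σ)`, and the last is evaluated by `prod_inversions`. This is why suspension exchanges
skew-symmetry and symmetry. -/
lemma koszulSign_add_one {n : ℕ} (σ : Equiv.Perm (Fin n)) (d : Fin n → ℤ) :
    koszulSign σ (fun t => d t + 1) =
      skewSign σ d * (decalageSign (fun t => d (σ t)) * decalageSign d) := by
  rw [decalageSign_eq_prod, decalageSign_eq_prod,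
    ← prod_inversions σ fun t => Int.negOnePow (d t), skewSign, sign_eq_prod_inversions, koszulSign,
    koszulSign]
  simp_rw [← Finset.prod_mul_distrib]
  refine Finset.prod_congr rfl fun p _ => Finset.prod_congr rfl fun q _ => ?_
  split_ifs
  · rw [← Int.negOnePow_one, ← Int.negOnePow_add, ← Int.negOnePow_add, ← Int.negOnePow_add]
    congr 1
    ring
  · simp

/-- The source of `(-1)^{i(j-1)}` in the Jacobi identity: the inner value has degree `∑ e + i - 2`
and occupies the first slot of the outer map, where its weight is `m = j - 1`. -/
lemma decalageSign_nested {n i m j : ℕ} (hi : 1 ≤ i) (hn : i + m = n) (hj : j = m + 1) (e : Fin n → ℤ) :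
    decalageSign (fun u : Fin i => e ⟨u, by omega⟩) *
      decalageSign (fun t : Fin j => if (t : ℕ) = 0 then
        ∑ u : Fin i, e ⟨u, by omega⟩ + ((i : ℤ) - 2) else e ⟨i + t - 1, by omega⟩) =
      decalageSign e * (-1) ^ (i * m) := by
  subst hn hj
  have h2 : (-1 : ℤˣ) ^ (i * m) = Int.negOnePow ((i * m : ℕ) : ℤ) := by
    rw [Int.negOnePow_def, zpow_natCast]
  have h3 : ∀ t : Fin m, (⟨i + ((t : ℕ) + 1) - 1, by omega⟩ : Fin (i + m)) = Fin.natAdd i t :=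
    fun t => rfl
  rw [h2, decalageSign, decalageSign, decalageSign, ← Int.negOnePow_add, ← Int.negOnePow_add,
    Int.negOnePow_eq_iff, Fin.sum_univ_succ, Fin.sum_univ_add]
  simp only [Fin.val_zero, if_true, Fin.val_succ, Nat.add_eq_zero_iff, one_ne_zero, and_false,
    if_false, h3, Fin.val_castAdd, Fin.val_natAdd]
  have h4 : ∑ u : Fin i, (((i + m : ℕ) : ℤ) - 1 - (u : ℕ)) * e (Fin.castAdd m u) =
      ∑ u : Fin i, ((i : ℤ) - 1 - (u : ℕ)) * e (Fin.castAdd m u) +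
        m * ∑ u : Fin i, e (Fin.castAdd m u) := by
    rw [Finset.mul_sum, ← Finset.sum_add_distrib]
    refine Finset.sum_congr rfl fun u _ => ?_
    push_cast
    ring
  have h5 : ∑ t : Fin m, (((i + m : ℕ) : ℤ) - 1 - ((i + t : ℕ) : ℤ)) * e (Fin.natAdd i t) =
      ∑ t : Fin m, (((m + 1 : ℕ) : ℤ) - 1 - ((t + 1 : ℕ) : ℤ)) * e (Fin.natAdd i t) := by
    refine Finset.sum_congr rfl fun u _ => ?_
    push_cast
    ring
  have h6 : ∀ u : Fin i, (⟨u, by omega⟩ : Fin (i + m)) = Fin.castAdd m u := fun u => rfl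
  rw [h4, h5]
  simp only [h6]
  -- The two exponents differ by `-2m`, from the `-2` in the degree of the inner operation.
  refine ⟨-m, ?_⟩
  push_cast
  ring

end Signs

end

/-! ### Translation between operations on `L` and components on `S(sL)`. -/

section

open GSym

variable {K L : Type*} [Field K] [AddCommGroup L] [Module K L]
  (𝓛 : ℤ → Submodule K L) [DirectSum.Decomposition 𝓛]

/-- The décalage of a multilinear map: on homogeneous elements it is multiplied by
`decalageSign`. -/
def decalage {k : ℕ} (f : MultilinearMap K (fun _ : Fin k => L) L) :
    MultilinearMap K (fun _ : Fin k => L) L :=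
  f.compLinearMap fun t => koszulTwist 𝓛 ((k : ℤ) - 1 - (t : ℕ))

lemma decalage_decalage {k : ℕ} (f : MultilinearMap K (fun _ : Fin k => L) L) :
    decalage 𝓛 (decalage 𝓛 f) = f := by
  ext v
  simp [decalage, koszulTwist_self]

lemma decalage_apply {k : ℕ} (f : MultilinearMap K (fun _ : Fin k => L) L) {d : Fin k → ℤ}
    {a : Fin k → L} (ha : ∀ t, a t ∈ 𝓛 (d t)) :
    decalage 𝓛 f a = signHom K (decalageSign d) • f a := by
  rw [decalage, MultilinearMap.compLinearMap_apply]
  simp_rw [fun t : Fin k => koszulTwist_of_mem 𝓛 ((k : ℤ) - 1 - (t : ℕ)) (ha t)]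
  rw [MultilinearMap.map_smul_univ, ← map_prod, ← negOnePow_sum, decalageSign]

omit [DirectSum.Decomposition 𝓛] in
lemma mem_susp {i j : ℤ} (h : j = i + 1) {x : L} : x ∈ susp 𝓛 j ↔ x ∈ 𝓛 i := by
  subst h
  rw [susp, add_sub_cancel_right]

variable {𝓛} {α : L →ₗ[K] L}

lemma HLInfinity.decalage_symm (H : HLInfinity 𝓛 α) {k : ℕ} (hk : 1 ≤ k) (d : Fin k → ℤ)
    (a : Fin k → L) (ha : ∀ t, a t ∈ susp 𝓛 (d t)) (σ : Equiv.Perm (Fin k)) :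
    decalage 𝓛 (H.l k) a =
      signHom K (koszulSign σ d) • decalage 𝓛 (H.l k) (fun t => a (σ t)) := by
  have ha' : ∀ t, a t ∈ 𝓛 (d t - 1) := ha
  have hs := koszulSign_add_one σ fun t => d t - 1
  simp only [sub_add_cancel] at hs
  rw [decalage_apply 𝓛 _ ha', decalage_apply 𝓛 _ (fun t => ha' (σ t)), H.skew k hk _ a ha',
    units_smul_eq (K := K), smul_smul, smul_smul, ← map_mul, ← map_mul, hs]
  congr 2
  rcases Int.units_eq_one_or (decalageSign fun t => d (σ t) - 1) with h | h <;>
    rcases Int.units_eq_one_or (skewSign σ fun t => d t - 1) with h' | h' <;> simp [h, h']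

variable (hα : HasDegree 𝓛 𝓛 0 α)

include hα in
lemma decalage_comm {k : ℕ} {f : MultilinearMap K (fun _ : Fin k => L) L}
    (hf : ∀ a : Fin k → L, α (f a) = f fun t => α (a t)) (a : Fin k → L) :
    α (decalage 𝓛 f a) = decalage 𝓛 f fun t => α (a t) := by
  simp only [decalage, MultilinearMap.compLinearMap_apply, hf]
  congr 1
  ext t
  have := hα.koszulTwist_apply 𝓛 𝓛 ((k : ℤ) - 1 - (t : ℕ)) (a t)
  rw [mul_zero, Int.negOnePow_zero, map_one, one_smul] at this
  exact this.symm

include hα in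
lemma HLInfinity.exists_component (H : HLInfinity 𝓛 α) {k : ℕ} (hk : 1 ≤ k) :
    ∃ ρ : GSym (susp 𝓛) →ₗ[K] L, IsComponent (susp 𝓛) α (-1) k ρ ∧
      ∀ v, ρ (wedge (susp 𝓛) v) = decalage 𝓛 (H.l k) v := by
  obtain ⟨ρ, hρ, hsupp⟩ := exists_linearMap_of_symmetric (susp 𝓛) (decalage 𝓛 (H.l k))
    (H.decalage_symm hk)
  refine ⟨ρ, ⟨hsupp, ?_, fun v => ?_⟩, hρ⟩
  · intro i x hx
    induction hx using Submodule.span_induction with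
    | mem x hx =>
      obtain ⟨n, d, v, hv, rfl, rfl⟩ := hx
      rcases eq_or_ne n k with rfl | hn
      · have hv' : ∀ t, v t ∈ 𝓛 (d t - 1) := hv
        rw [hρ, decalage_apply 𝓛 _ hv']
        refine Submodule.smul_mem _ _ ((mem_susp 𝓛 ?_).2 (H.degree n hk _ v hv'))
        rw [Finset.sum_sub_distrib]
        simp
        ring
      · rw [hsupp n hn _ (wedge_mem_symPow _ v)]
        exact zero_mem _
    | zero => rw [map_zero]; exact zero_mem _
    | add x y _ _ hx hy => rw [map_add]; exact add_mem hx hy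
    | smul c x _ hx => rw [map_smul]; exact Submodule.smul_mem _ _ hx
  · rw [hρ, hρ, decalage_comm hα (H.comm k hk)]

section Jacobi

variable {ρ : ℕ → GSym (susp 𝓛) →ₗ[K] L} {l : ∀ k : ℕ, MultilinearMap K (fun _ : Fin k => L) L}
  (hρ : ∀ k, 1 ≤ k → IsComponent (susp 𝓛) α (-1) k (ρ k))
  (hl : ∀ k, 1 ≤ k → ∀ v, ρ k (wedge (susp 𝓛) v) = decalage 𝓛 (l k) v)

include hρ hl in
lemma degree_of_components {k : ℕ} (hk : 1 ≤ k) (d : Fin k → ℤ) (a : Fin k → L)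
    (ha : ∀ t, a t ∈ 𝓛 (d t)) : l k a ∈ 𝓛 (∑ t, d t + ((k : ℤ) - 2)) := by
  have ha' : ∀ t, a t ∈ susp 𝓛 (d t + 1) := fun t => (mem_susp 𝓛 rfl).2 (ha t)
  have h1 := (hρ k hk).degree _ _ (wedge_mem_deg (susp 𝓛) ha')
  rw [hl k hk, decalage_apply 𝓛 _ ha] at h1
  have h2 := Submodule.smul_mem _ (signHom K (decalageSign d)) h1
  rw [signHom_smul_smul_self] at h2
  refine (mem_susp 𝓛 ?_).1 h2
  rw [Finset.sum_add_distrib]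
  simp
  ring

include hl in
lemma skew_of_components {k : ℕ} (hk : 1 ≤ k) (d : Fin k → ℤ) (a : Fin k → L)
    (ha : ∀ t, a t ∈ 𝓛 (d t)) (σ : Equiv.Perm (Fin k)) :
    l k (fun t => a (σ t)) = skewSign σ d • l k a := by
  have ha' : ∀ t, a t ∈ susp 𝓛 (d t + 1) := fun t => (mem_susp 𝓛 rfl).2 (ha t)
  have h1 := congrArg (ρ k) (wedge_perm (susp 𝓛) ha' σ)
  rw [map_smul, hl k hk, hl k hk, decalage_apply 𝓛 _ ha, decalage_apply 𝓛 _ (fun t => ha (σ t)),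
    koszulSign_add_one, smul_smul, ← map_mul] at h1
  have h2 : skewSign σ d * (decalageSign (fun t => d (σ t)) * decalageSign d) *
      decalageSign (fun t => d (σ t)) = decalageSign d * skewSign σ d := by
    rw [mul_comm (decalageSign fun t => d (σ t)), ← mul_assoc, mul_assoc _ (decalageSign _),
      Int.units_mul_self, mul_one, mul_comm]
  rw [h2, map_mul, mul_smul] at h1
  have h3 := congrArg (fun x => signHom K (skewSign σ d) • signHom K (decalageSign d) • x) h1
  simp only [signHom_smul_smul_self] at h3
  rw [units_smul_eq (K := K), h3]

-- Both sides are sums over the same unshuffles. In each term the signs of the inner and outer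
-- décalage combine by `decalageSign_nested`, the Koszul sign is converted by `koszulSign_add_one`,
-- and the signs of the permuted degrees cancel, leaving a factor independent of `σ` and `r`.
include hρ hl in
lemma component_componentLift {n : ℕ} {d : Fin n → ℤ} {a : Fin n → L}
    (ha : ∀ t, a t ∈ 𝓛 (d t)) (r : Fin n) :
    ρ (n - r) (componentLift hα.susp ρ ((r : ℕ) + 1) (wedge (susp 𝓛) a)) =
      signHom K (decalageSign d) • ∑ σ ∈ unshuffles n ((r : ℕ) + 1),
        (skewSign σ d * (-1) ^ (((r : ℕ) + 1) * (n - (r : ℕ) - 1))) •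
          nested α l a σ ((r : ℕ) + 1) (n - (r : ℕ)) (by omega) (by omega) (by omega) := by
  have ha' : ∀ t, a t ∈ susp 𝓛 (d t + 1) := fun t => (mem_susp 𝓛 rfl).2 (ha t)
  rw [componentLift, twistedLift_wedge (susp 𝓛) _ _ (hρ _ (by omega)).supported (by omega) ha',
    map_sum, Finset.smul_sum]
  refine Finset.sum_congr rfl fun σ _ => ?_
  have hfirst : ∀ t : Fin ((r : ℕ) + 1), a (σ ⟨t, by omega⟩) ∈ 𝓛 (d (σ ⟨t, by omega⟩)) :=
    fun t => ha _
  -- The arguments of the outer operation. Their degrees are needed to evaluate its décalage, which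
  -- is where the degree of the inner operation enters.
  let b : Fin (n - r) → L := fun t =>
    if (t : ℕ) = 0 then l ((r : ℕ) + 1) fun u : Fin ((r : ℕ) + 1) => a (σ ⟨u, by omega⟩)
    else (α ^ ((r : ℕ) + 1 - 1)) (a (σ ⟨(r : ℕ) + 1 + t - 1, by omega⟩))
  have hb : ∀ t : Fin (n - r), b t ∈ 𝓛 (if (t : ℕ) = 0 then
      ∑ u : Fin ((r : ℕ) + 1), d (σ ⟨u, by omega⟩) + ((((r : ℕ) + 1 : ℕ) : ℤ) - 2)
        else d (σ ⟨(r : ℕ) + 1 + t - 1, by omega⟩)) := by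
    intro t
    by_cases ht : (t : ℕ) = 0
    · simp only [b, if_pos ht]
      exact degree_of_components hρ hl (by omega) _ _ hfirst
    · simp only [b, if_neg ht]
      have := hα.pow ((r : ℕ) + 1 - 1) _ _ (ha (σ ⟨(r : ℕ) + 1 + t - 1, by omega⟩))
      rwa [add_zero] at this
  have hwedge : ι (susp 𝓛) (l ((r : ℕ) + 1) fun u : Fin ((r : ℕ) + 1) => a (σ ⟨u, by omega⟩)) *
      wedge (susp 𝓛) (fun t : Fin (n - ((r : ℕ) + 1)) =>
        (α ^ ((r : ℕ) + 1 - 1)) (a (σ ⟨(r : ℕ) + 1 + t, by omega⟩))) = wedge (susp 𝓛) b := by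
    rw [ι_mul_wedge (susp 𝓛) (m := n - ((r : ℕ) + 1)) (by omega) b]
    rfl
  have hsign := decalageSign_nested (n := n) (i := (r : ℕ) + 1) (m := n - ((r : ℕ) + 1))
    (j := n - r) (by omega) (by omega) (by omega) fun t => d (σ t)
  rw [hl _ (by omega), decalage_apply 𝓛 _ hfirst, map_smul (ι _), smul_mul_assoc, hwedge, map_smul,
    map_smul, hl _ (by omega), decalage_apply 𝓛 _ hb, units_smul_eq (K := K), smul_smul, smul_smul,
    smul_smul, ← map_mul, ← map_mul, ← map_mul, mul_assoc, hsign, koszulSign_add_one]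
  have h2 : skewSign σ d * (decalageSign (fun t => d (σ t)) * decalageSign d) *
      (decalageSign (fun t => d (σ t)) * (-1) ^ (((r : ℕ) + 1) * (n - ((r : ℕ) + 1)))) =
        decalageSign d * (skewSign σ d * (-1) ^ (((r : ℕ) + 1) * (n - (r : ℕ) - 1))) := by
    rw [Nat.sub_sub, mul_left_comm (decalageSign d)]
    rcases Int.units_eq_one_or (decalageSign fun t => d (σ t)) with h | h <;> simp [h, mul_assoc]
  rw [h2]
  rfl

include hρ hl in
lemma sum_component_componentLift {n : ℕ} {d : Fin n → ℤ} {a : Fin n → L}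
    (ha : ∀ t, a t ∈ 𝓛 (d t)) :
    (∑ r : Fin n, ρ (n - r) (componentLift hα.susp ρ ((r : ℕ) + 1) (wedge (susp 𝓛) a)) = 0) ↔
      ∑ r : Fin n, ∑ σ ∈ unshuffles n ((r : ℕ) + 1),
        (skewSign σ d * (-1) ^ (((r : ℕ) + 1) * (n - (r : ℕ) - 1))) •
          nested α l a σ ((r : ℕ) + 1) (n - (r : ℕ)) (by omega) (by omega) (by omega) = 0 := by
  simp only [component_componentLift hα hρ hl ha]
  rw [← Finset.smul_sum]
  constructor
  · intro h
    have := congrArg (fun x => signHom K (decalageSign d) • x) h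
    simpa only [signHom_smul_smul_self, smul_zero] using this
  · intro h
    rw [h, smul_zero]

include hρ hl in
lemma IsSumOfLifts.comp_self_eq_zero_iff_jacobi [CharZero K]
    {D : GSym (susp 𝓛) →ₗ[K] GSym (susp 𝓛)} (hD : IsSumOfLifts (susp 𝓛) α hα.susp (-1) ρ D) :
    D ∘ₗ D = 0 ↔ ∀ n, 1 ≤ n → ∀ (d : Fin n → ℤ) (a : Fin n → L), (∀ t, a t ∈ 𝓛 (d t)) →
      ∑ r : Fin n, ∑ σ ∈ unshuffles n ((r : ℕ) + 1),
        (skewSign σ d * (-1) ^ (((r : ℕ) + 1) * (n - (r : ℕ) - 1))) •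
          nested α l a σ ((r : ℕ) + 1) (n - (r : ℕ)) (by omega) (by omega) (by omega) = 0 := by
  rw [hD.comp_self_eq_zero_iff hα.susp (by decide)]
  refine forall₂_congr fun n _ => ⟨fun h d a ha => ?_, fun h d a ha => ?_⟩
  · exact (sum_component_componentLift hα hρ hl ha).1
      (h _ a fun t => (mem_susp 𝓛 rfl).2 (ha t))
  · exact (sum_component_componentLift hα hρ hl ha).2 (h (fun t => d t - 1) a ha)

end Jacobi

lemma HLInfinity.exists_coderivation [CharZero K] (H : HLInfinity 𝓛 α) :
    ∃ D : {D : GSym (susp 𝓛) →ₗ[K] GSym (susp 𝓛) //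
        D ∈ Coder (susp 𝓛) α hα.susp (-1) ∧ D ∘ₗ D = 0},
      ∃ ρ : ℕ → GSym (susp 𝓛) →ₗ[K] L, IsSumOfLifts (susp 𝓛) α hα.susp (-1) ρ D ∧
        ∀ k, 1 ≤ k → ∀ v, ρ k (wedge (susp 𝓛) v) = decalage 𝓛 (H.l k) v := by
  have h : ∀ k, ∃ ρ : GSym (susp 𝓛) →ₗ[K] L, 1 ≤ k → (IsComponent (susp 𝓛) α (-1) k ρ ∧
      ∀ v, ρ (wedge (susp 𝓛) v) = decalage 𝓛 (H.l k) v) := by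
    intro k
    by_cases hk : 1 ≤ k
    · obtain ⟨ρ, hρ⟩ := H.exists_component hα hk
      exact ⟨ρ, fun _ => hρ⟩
    · exact ⟨0, fun h => absurd h hk⟩
  choose ρ hρ using h
  obtain ⟨D, hD⟩ := exists_isSumOfLifts hα.susp fun n hn => (hρ n hn).1
  exact ⟨⟨D, ⟨ρ, hD⟩, (hD.comp_self_eq_zero_iff_jacobi hα (fun n hn => (hρ n hn).1)
    fun k hk => (hρ k hk).2).2 H.jacobi⟩, ρ, hD, fun k hk => (hρ k hk).2⟩

lemma exists_hlInfinity [CharZero K] {ρ : ℕ → GSym (susp 𝓛) →ₗ[K] L}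
    {D : GSym (susp 𝓛) →ₗ[K] GSym (susp 𝓛)} (hD : IsSumOfLifts (susp 𝓛) α hα.susp (-1) ρ D)
    (h0 : D ∘ₗ D = 0) : ∃ H : HLInfinity 𝓛 α,
      ∀ k, 1 ≤ k → ∀ v, ρ k (wedge (susp 𝓛) v) = decalage 𝓛 (H.l k) v := by
  -- Décalage is an involution, so applying it to the components recovers the operations. The value
  -- at `k = 0` is the normalisation required by `HLInfinity`.
  let l : ∀ k : ℕ, MultilinearMap K (fun _ : Fin k => L) L := fun k => if k = 0 then 0 else
    decalage 𝓛 ((ρ k).compMultilinearMap (wedgeMultilinear (susp 𝓛) k))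
  have hl : ∀ k, 1 ≤ k → ∀ v, ρ k (wedge (susp 𝓛) v) = decalage 𝓛 (l k) v := by
    intro k hk v
    simp only [l, if_neg (show k ≠ 0 by omega)]
    rw [decalage_decalage, LinearMap.compMultilinearMap_apply, wedgeMultilinear_apply]
  refine ⟨⟨l, if_pos rfl, fun k hk => degree_of_components hD.1 hl hk,
    fun k hk => skew_of_components hl hk, fun k hk => ?_,
    (hD.comp_self_eq_zero_iff_jacobi hα hD.1 hl).1 h0⟩, hl⟩
  have h1 : ∀ v, α (decalage 𝓛 (l k) v) = decalage 𝓛 (l k) fun t => α (v t) := fun v => by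
    rw [← hl k hk, ← hl k hk, (hD.1 k hk).comm]
  have h2 := decalage_comm hα h1
  rwa [decalage_decalage] at h2

end

end HomLie

end

/-! ### The bijection. -/

theorem mainTheorem11 {K L : Type*} [Field K] [CharZero K] [AddCommGroup L] [Module K L]
    (𝓛 : ℤ → Submodule K L) [DirectSum.Decomposition 𝓛]
    (α : L →ₗ[K] L) (hα : HomLie.HasDegree 𝓛 𝓛 0 α) :
    ∃ Φ : HomLie.HLInfinity 𝓛 α ≃
        {D : HomLie.GSym (HomLie.susp 𝓛) →ₗ[K] HomLie.GSym (HomLie.susp 𝓛) //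
          D ∈ HomLie.Coder (HomLie.susp 𝓛) α hα.susp (-1) ∧ D ∘ₗ D = 0},
      ∀ H : HomLie.HLInfinity 𝓛 α, ∃ ρ : ℕ → HomLie.GSym (HomLie.susp 𝓛) →ₗ[K] L,
        HomLie.IsSumOfLifts (HomLie.susp 𝓛) α hα.susp (-1) ρ (Φ H) ∧
        ∀ k, 1 ≤ k → ∀ (d : Fin k → ℤ) (a : Fin k → L), (∀ t, a t ∈ 𝓛 (d t)) →
          ρ k (HomLie.GSym.wedge (HomLie.susp 𝓛) a) =
            ((-1 : ℤˣ) ^ (k * (k - 1) / 2) *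
              Int.negOnePow (∑ t : Fin k, ((k : ℤ) - 1 - (t : ℕ)) * (d t + 1))) • H.l k a := by
  choose F ρ hD hρ using fun H : HomLie.HLInfinity 𝓛 α => H.exists_coderivation hα
  have hinj : Function.Injective F := by
    intro H H' h
    refine HomLie.HLInfinity.ext (funext fun k => ?_)
    rcases Nat.eq_zero_or_pos k with rfl | hk
    · rw [H.l_zero, H'.l_zero]
    rw [← HomLie.decalage_decalage 𝓛 (H.l k), ← HomLie.decalage_decalage 𝓛 (H'.l k)]
    congr 1
    ext v
    have hv := HomLie.GSym.wedge_mem_symPow (HomLie.susp 𝓛) v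
    rw [← hρ H k hk, ← hρ H' k hk, ← (hD H).proj_apply hα.susp hk hv,
      ← (hD H').proj_apply hα.susp hk hv, h]
  have hsurj : Function.Surjective F := by
    rintro ⟨D, ⟨ρ', hD'⟩, h0⟩
    obtain ⟨H, hH⟩ := HomLie.exists_hlInfinity hα hD' h0
    refine ⟨H, Subtype.ext (LinearMap.ext fun x => ?_)⟩
    -- The components chosen for `H` agree with the given ones in arity at least `1`. The entries at
    -- `n = 0` are unconstrained, but do not enter the sum defining `D`.
    have hρρ : ∀ n, 1 ≤ n → ρ H n = ρ' n := by
      intro n hn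
      refine HomLie.GSym.linearMap_ext_wedge (HomLie.susp 𝓛) fun m d v _ => ?_
      have hv := HomLie.GSym.wedge_mem_symPow (HomLie.susp 𝓛) v
      rcases eq_or_ne m n with rfl | hm
      · rw [hρ H m hn, hH m hn]
      · rw [((hD H).1 n hn).supported m hm _ hv, (hD'.1 n hn).supported m hm _ hv]
    rw [((HomLie.isSumOfLifts_iff hα.susp).1 (hD H)).2 x,
      ((HomLie.isSumOfLifts_iff hα.susp).1 hD').2 x]
    refine finsum_congr fun n => finsum_congr fun hn => ?_
    rw [HomLie.componentLift, HomLie.componentLift, hρρ n hn]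
  refine ⟨Equiv.ofBijective F ⟨hinj, hsurj⟩, fun H => ⟨ρ H, hD H, fun k hk d a ha => ?_⟩⟩
  rw [hρ H k hk, HomLie.decalage_apply 𝓛 _ ha, HomLie.suspension_sign,
    HomLie.units_smul_eq (K := K)]
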